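/- \textbf{Setting.} All algebras are finitely generated and nonzero. Let $R$ be an $\mathbb N$-graded algebra over a field $k$ with $R_0=k$, generated over $k$ by elements of a single degree $g\ge 1$, and let $S$ be an $\mathbb N$-graded algebra over a field $l$ with $S_0=l$, generated over $l$ by elements of a single degree $h\ge 1$. Let $\mathfrak m$ and $\mathfrak n$ be their graded maximal ideals. Let $\varphi:R\to S$ be a ring homomorphism of order $d\ge 1$, that is, $\varphi(R_j)\subseteq S_{dj}$ for all $j$, and assume $dg=hc$ with $c\ge 1$ an integer (this is automatic when $\varphi(R_g)\ne 0$). For $s\ge 1$ the fractional Veronese $R^{(1/s)}$ is the ring $R$ with the grading $R^{(1/s)}_{si}=R_i$ and $R^{(1/s)}_j=0$ if $s\nmid j$; the fractional Veronese $M^{(1/s)}$ of a complex $M$ of graded modules is defined in the same way. Then $\varphi:R^{(1/d)}\to S$ is homogeneous. Let $M$ be a complex of graded $S$-modules such that every $H_i(M)$ is a finitely generated $S$-module and $H_i(M)=0$ for $i\ll 0$. Let $\mathbf x$ be a minimal system of generators of $\mathfrak n^c$ modulo $\mathfrak mS$ consisting of elements of degree $dg$, and let $K[\mathbf x;M]$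 be the Koszul complex. The regularity of $M$ over $\varphi$ is $$\operatorname{reg}_\varphi M=\sup\Bigl\{\tfrac{j-idg}{dg} : H_i\bigl(k\otimes^{\mathbf L}_{R^{(1/d)}}K[\mathbf x;M]\bigr)_j\neq 0\Bigr\}\in[-\infty,\infty].$$ Let $S^{(d)}=\bigoplus_u S_{du}$ be the $d$-th Veronese subring, with $S^{(d)}_u=S_{du}$; it is generated in degree $h/\gcd(d,h)$. Let $\widehat\varphi:R\to S^{(d)}$ be the homogeneous homomorphism induced by $\varphi$, and let ${}^{\varphi}M=\bigoplus_{r=0}^{d-1}V_r(d,M)$, where $V_r(d,M)=\bigoplus_u M_{du+r}$ with $M_{du+r}$ in degree $u$, viewed as a complex of graded $S^{(d)}$-modules. \textbf{Theorem.} With the above notation, the following hold, whichever minimal systems of generators are used to compute the regularities. \begin{enumerate} \item[(i)] For every $t\ge 1$, let $\varphi^{(1/t)}:R^{(1/t)}\to S^{(1/t)}$ be the homomorphism of order $d$ induced by $\varphi$. Then $\operatorname{reg}_\varphi M=\operatorname{reg}_{\varphi^{(1/t)}}M^{(1/t)}$. \item[(ii)] $\displaystyle \operatorname{reg}_{\widehat\varphi}({}^{\varphi}M)\le\operatorname{reg}_\varphi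 M\le\operatorname{reg}_{\widehat\varphi}({}^{\varphi}M)+\frac{d-1}{dg}.$ \end{enumerate} -/

import Mathlib

open scoped TensorProduct

universe u v w u₁ v₁

noncomputable section

/-! ## Graded algebras -/

/-- `R` is a finitely generated algebra over the field `k`, graded by `𝒜` in nonnegative degrees
with degree-zero part `k`, and generated over `k` by its elements of the single degree `g ≥ 1`. -/
structure IsGeneratedInDegree {k : Type u₁} {R : Type u} [Field k] [CommRing R] [Algebra k R]
    (𝒜 : ℤ → Submodule k R) (g : ℕ) : Prop where
  nontrivial : Nontrivial R
  finiteType : Algebra.FiniteType k R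
  neg : ∀ j : ℤ, j < 0 → 𝒜 j = ⊥
  zero : 𝒜 0 = 1
  pos : 0 < g
  adjoin : Algebra.adjoin k (𝒜 g : Set R) = ⊤

/-- The ideal generated by all homogeneous elements of positive degree: the graded maximal ideal
of an `ℕ`-graded algebra whose degree-zero part is a field. -/
def irrelevantIdeal {k : Type u₁} {R : Type u} [Field k] [CommRing R] [Algebra k R]
    (𝒜 : ℤ → Submodule k R) : Ideal R :=
  Ideal.span {a | ∃ j : ℤ, 0 < j ∧ a ∈ 𝒜 j}

/-- The grading of the `s`-th fractional Veronese `R^{(1/s)}`: the ring `R` itself, with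
`R^{(1/s)}_{si} = R_i` and with zero components in the degrees that `s` does not divide. -/
def fracGrading {k : Type u₁} {R : Type u} [Field k] [CommRing R] [Algebra k R]
    (s : ℕ) (𝒜 : ℤ → Submodule k R) (j : ℤ) : Submodule k R :=
  if (s : ℤ) ∣ j then 𝒜 (j / s) else ⊥

/-- The `d`-th Veronese subring `S^{(d)} = ⨁ᵤ S_{du}`. -/
def veronese {l : Type v₁} {S : Type v} [Field l] [CommRing S] [Algebra l S]
    (𝒮 : ℤ → Submodule l S) [GradedAlgebra 𝒮] (d : ℕ) : Subalgebra l S :=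
  (⨆ u : ℤ, 𝒮 (d * u)).toSubalgebra
    (Submodule.mem_iSup_of_mem 0 (by simpa using SetLike.GradedOne.one_mem (A := 𝒮)))
    (by
      intro x y hx hy
      induction hx using Submodule.iSup_induction' with
      | zero => simp
      | add a b _ _ ha hb => rw [add_mul]; exact add_mem ha hb
      | mem i a ha =>
        induction hy using Submodule.iSup_induction' with
        | zero => simp
        | add b c _ _ hb hc => rw [mul_add]; exact add_mem hb hc
        | mem j b hb =>
          refine Submodule.mem_iSup_of_mem (i + j) ?_
          rw [mul_add]
          exact SetLike.GradedMul.mul_mem ha hb)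

/-- The grading `S^{(d)}_u = S_{du}` of the Veronese subring. -/
def veroneseGrading {l : Type v₁} {S : Type v} [Field l] [CommRing S] [Algebra l S]
    (𝒮 : ℤ → Submodule l S) [GradedAlgebra 𝒮] (d : ℕ) (u : ℤ) : Submodule l (veronese 𝒮 d) :=
  (𝒮 (d * u)).comap (veronese 𝒮 d).val.toLinearMap

/-- The ring homomorphism `φ` multiplies degrees by `d`: it has order `d`. -/
def HasOrder {k : Type u₁} {l : Type v₁} {R : Type u} {S : Type v} [Field k] [Field l]
    [CommRing R] [CommRing S] [Algebra k R] [Algebra l S]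
    (𝒜 : ℤ → Submodule k R) (𝒮 : ℤ → Submodule l S) (φ : R →+* S) (d : ℕ) : Prop :=
  0 < d ∧ ∀ (j : ℤ) (a : R), a ∈ 𝒜 j → φ a ∈ 𝒮 (d * j)

theorem HasOrder.map_mem_veronese {k : Type u₁} {l : Type v₁} {R : Type u} {S : Type v}
    [Field k] [Field l] [CommRing R] [CommRing S] [Algebra k R] [Algebra l S]
    {𝒜 : ℤ → Submodule k R} [GradedAlgebra 𝒜] {𝒮 : ℤ → Submodule l S} [GradedAlgebra 𝒮]
    {φ : R →+* S} {d : ℕ} (h : HasOrder 𝒜 𝒮 φ d) (r : R) : φ r ∈ veronese 𝒮 d := by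
  induction r using DirectSum.Decomposition.inductionOn 𝒜 with
  | zero => rw [map_zero]; exact zero_mem _
  | @homogeneous i m => exact Submodule.mem_iSup_of_mem i (h.2 i m m.2)
  | add a b ha hb => rw [map_add]; exact add_mem ha hb

/-- The homogeneous homomorphism `R → S^{(d)}` induced by a homomorphism `φ : R → S` of
order `d`. -/
def HasOrder.toVeronese {k : Type u₁} {l : Type v₁} {R : Type u} {S : Type v}
    [Field k] [Field l] [CommRing R] [CommRing S] [Algebra k R] [Algebra l S]
    {𝒜 : ℤ → Submodule k R} [GradedAlgebra 𝒜] {𝒮 : ℤ → Submodule l S} [GradedAlgebra 𝒮]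
    {φ : R →+* S} {d : ℕ} (h : HasOrder 𝒜 𝒮 φ d) : R →+* veronese 𝒮 d :=
  φ.codRestrict (veronese 𝒮 d) h.map_mem_veronese

/-! ## Complexes of graded modules -/

/-- The data of a chain complex of graded `S`-modules, written as one module
`M = ⨁_{i,j} (M_i)_j` with an endomorphism `d`: the subgroup `gr i j` is the degree-`j` component
of the module in homological degree `i`. The axioms are in `GrComplex.IsGraded`. -/
structure GrComplex (S : Type v) [CommRing S] where
  carrier : Type w
  [addCommGroup : AddCommGroup carrier]
  [module : Module S carrier]
  d : carrier →ₗ[S] carrier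
  gr : ℤ → ℤ → AddSubgroup carrier

attribute [instance] GrComplex.addCommGroup GrComplex.module

namespace GrComplex

/-- `M` is a chain complex of graded modules over the graded ring `(S, 𝒮)`. -/
structure IsGraded {l : Type v₁} {S : Type v} [Field l] [CommRing S] [Algebra l S]
    (𝒮 : ℤ → Submodule l S) (M : GrComplex.{v, w} S) : Prop where
  isInternal : DirectSum.IsInternal (fun p : ℤ × ℤ => M.gr p.1 p.2)
  smul_mem : ∀ (a i b : ℤ) (s : S) (m : M.carrier),
    s ∈ 𝒮 a → m ∈ M.gr i b → s • m ∈ M.gr i (a + b)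
  d_mem : ∀ (i j : ℤ) (m : M.carrier), m ∈ M.gr i j → M.d m ∈ M.gr (i - 1) j
  d_comp_d : M.d ∘ₗ M.d = 0

/-- The module `M_i` in homological degree `i`. -/
def term {S : Type v} [CommRing S] (M : GrComplex.{v, w} S) (i : ℤ) : Submodule S M.carrier :=
  Submodule.span S {m | ∃ j : ℤ, m ∈ M.gr i j}

/-- The cycles of `M` in homological degree `i`. -/
def cycles {S : Type v} [CommRing S] (M : GrComplex.{v, w} S) (i : ℤ) : Submodule S M.carrier :=
  LinearMap.ker M.d ⊓ M.term i

/-- The boundaries of `M` in homological degree `i`. -/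
def boundaries {S : Type v} [CommRing S] (M : GrComplex.{v, w} S) (i : ℤ) :
    Submodule S M.carrier :=
  (M.term (i + 1)).map M.d

/-- The homology module `H_i(M)`. -/
abbrev homology {S : Type v} [CommRing S] (M : GrComplex.{v, w} S) (i : ℤ) : Type w :=
  M.cycles i ⧸ (M.boundaries i).submoduleOf (M.cycles i)

/-- The cycles of `M` of homological degree `i` and degree `j`. -/
def cyclesGr {S : Type v} [CommRing S] (M : GrComplex.{v, w} S) (i j : ℤ) :
    AddSubgroup M.carrier :=
  (LinearMap.ker M.d).toAddSubgroup ⊓ M.gr i j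

/-- The degree-`j` component `H_i(M)_j` of the `i`-th homology module. -/
abbrev homologyGr {S : Type v} [CommRing S] (M : GrComplex.{v, w} S) (i j : ℤ) : Type w :=
  M.cyclesGr i j ⧸ ((M.gr (i + 1) j).map M.d.toAddMonoidHom).addSubgroupOf (M.cyclesGr i j)

/-- `M` is a complex of graded modules over `(S, 𝒮)` whose homology modules are finitely generated
and vanish in all sufficiently small homological degrees. -/
structure IsHomFiniteBelow {l : Type v₁} {S : Type v} [Field l] [CommRing S] [Algebra l S]
    (𝒮 : ℤ → Submodule l S) (M : GrComplex.{v, w} S) : Prop where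
  isGraded : M.IsGraded 𝒮
  finite : ∀ i : ℤ, Module.Finite S (M.homology i)
  bounded : ∃ n : ℤ, ∀ i : ℤ, i < n → Subsingleton (M.homology i)

/-- Restriction of scalars along a ring homomorphism; the grading is kept. -/
def restrict {R : Type u} {S : Type v} [CommRing R] [CommRing S] (φ : R →+* S)
    (M : GrComplex.{v, w} S) : GrComplex.{u, w} R :=
  letI : Module R M.carrier := Module.compHom M.carrier φ
  { carrier := M.carrier
    d :=
      { toFun := M.d
        map_add' := M.d.map_add
        map_smul' := fun r m => M.d.map_smul (φ r) m }
    gr := M.gr }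

/-- The `s`-th fractional Veronese `M^{(1/s)}`: its component of degree `sj` is that of `M` of
degree `j`, and its components in the degrees that `s` does not divide are zero. -/
def frac {S : Type v} [CommRing S] (s : ℕ) (M : GrComplex.{v, w} S) : GrComplex.{v, w} S where
  carrier := M.carrier
  d := M.d
  gr i j := if (s : ℤ) ∣ j then M.gr i (j / s) else ⊥

/-- `⨁_{r < d} V_r(d, M)` as a complex over `S^{(d)}`, where `V_r(d, M) = ⨁ᵤ M_{du+r}` and
`M_{du+r}` has degree `u`. It is `M` itself with the Veronese grading. -/
def veroneseGraded {l : Type v₁} {S : Type v} [Field l] [CommRing S] [Algebra l S]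
    (𝒮 : ℤ → Submodule l S) [GradedAlgebra 𝒮] (d : ℕ) (M : GrComplex.{v, w} S) :
    GrComplex.{v, w} (veronese 𝒮 d) where
  carrier := M.carrier
  d := M.d.restrictScalars (veronese 𝒮 d)
  gr i u := ⨆ r : Fin d, M.gr i (d * u + (r : ℕ))

/-- The Koszul complex `K[x; M]` on one element `x` of degree `e`, that is, the mapping cone of
multiplication by `x`: in homological degree `i` it is `M_i ⊕ M_{i-1}(-e)`. -/
def koszulOne {S : Type v} [CommRing S] (e : ℤ) (x : S) (M : GrComplex.{v, w} S) :
    GrComplex.{v, w} S where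
  carrier := M.carrier × M.carrier
  d := LinearMap.prod
    (M.d ∘ₗ LinearMap.fst S M.carrier M.carrier + x • LinearMap.snd S M.carrier M.carrier)
    (-(M.d ∘ₗ LinearMap.snd S M.carrier M.carrier))
  gr i j := (M.gr i j).prod (M.gr (i - 1) (j - e))

/-- The Koszul complex `K[x₁, …, xₙ; M]` on a sequence of elements of the same degree `e`. -/
def koszul {S : Type v} [CommRing S] (e : ℤ) : List S → GrComplex.{v, w} S → GrComplex.{v, w} S
  | [], M => M
  | x :: xs, M => koszulOne e x (koszul e xs M)

end GrComplex

/-! ## A graded free resolution of the residue field -/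

/-- One step of a graded free resolution: the free module on `B`, the degrees of the basis
elements, and the submodule of cycles, which the next step has to cover. -/
structure ResStep (R : Type u) [CommRing R] where
  B : Type u
  deg : B → ℤ
  Z : Submodule R (B →₀ R)

/-- The resolution of `k = R/𝔪` starts with `R` and the submodule `𝔪`. Each further step is the
free module on the nonzero homogeneous elements `z` (of degree `e`, recorded as the pair `(e, z)`)
of the preceding submodule of cycles, and maps the basis element `(e, z)` to `z`. -/
def resStep {k : Type u₁} {R : Type u} [Field k] [CommRing R] [Algebra k R]
    (𝒜 : ℤ → Submodule k R) : ℕ → ResStep.{u} R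
  | 0 =>
    { B := PUnit
      deg := fun _ => 0
      Z := Submodule.comap (Finsupp.lapply PUnit.unit : (PUnit.{u + 1} →₀ R) →ₗ[R] R)
        (irrelevantIdeal 𝒜) }
  | p + 1 =>
    { B := {b : ℤ × ((resStep 𝒜 p).B →₀ R) // b.2 ∈ (resStep 𝒜 p).Z ∧ b.2 ≠ 0 ∧
        ∀ c, b.2 c ∈ 𝒜 (b.1 - (resStep 𝒜 p).deg c)}
      deg := fun b => b.1.1
      Z := LinearMap.ker (Finsupp.linearCombination R fun b => b.1.2) }

/-- The homogeneous basis of the whole resolution; the first component of a basis element is its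
homological degree. -/
abbrev ResBasis {k : Type u₁} {R : Type u} [Field k] [CommRing R] [Algebra k R]
    (𝒜 : ℤ → Submodule k R) : Type u :=
  Σ p : ℕ, (resStep 𝒜 p).B

/-- The differential on basis elements. -/
def resDBasis {k : Type u₁} {R : Type u} [Field k] [CommRing R] [Algebra k R]
    (𝒜 : ℤ → Submodule k R) : ResBasis 𝒜 → (ResBasis 𝒜 →₀ R)
  | ⟨0, _⟩ => 0
  | ⟨p + 1, b⟩ => Finsupp.mapDomain (Sigma.mk p) b.1.2

/-- The differential of the resolution. -/
def resD {k : Type u₁} {R : Type u} [Field k] [CommRing R] [Algebra k R]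
    (𝒜 : ℤ → Submodule k R) : (ResBasis 𝒜 →₀ R) →ₗ[R] (ResBasis 𝒜 →₀ R) :=
  Finsupp.linearCombination R (resDBasis 𝒜)

/-- Multiplication by `(-1)^p` on the part of homological degree `p` of the resolution. -/
def resSign {k : Type u₁} {R : Type u} [Field k] [CommRing R] [Algebra k R]
    (𝒜 : ℤ → Submodule k R) : (ResBasis 𝒜 →₀ R) →ₗ[R] (ResBasis 𝒜 →₀ R) :=
  Finsupp.linearCombination R fun b => Finsupp.single b ((-1) ^ b.1)

/-- The elements of homological degree `p` and degree `e` of the resolution. -/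
def resGr {k : Type u₁} {R : Type u} [Field k] [CommRing R] [Algebra k R]
    (𝒜 : ℤ → Submodule k R) (p e : ℤ) : AddSubgroup (ResBasis 𝒜 →₀ R) where
  carrier := {f | ∀ b : ResBasis 𝒜,
    f b ∈ 𝒜 (e - (resStep 𝒜 b.1).deg b.2) ∧ ((b.1 : ℤ) ≠ p → f b = 0)}
  zero_mem' := fun b => ⟨zero_mem _, fun _ => rfl⟩
  add_mem' := fun hf hg b => ⟨add_mem (hf b).1 (hg b).1, fun h => by
    rw [Finsupp.add_apply, (hf b).2 h, (hg b).2 h, add_zero]⟩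
  neg_mem' := fun hf b => ⟨neg_mem (hf b).1, fun h => by
    rw [Finsupp.neg_apply, (hf b).2 h, neg_zero]⟩

/-- The derived tensor product of `k` and `N` over the graded algebra `(R, 𝒜)`, as the complex
`G ⊗ N` with `G` the graded free resolution of `k` constructed above, and with the usual total
differential and gradings. -/
def derivedTensorResidue {k : Type u₁} {R : Type u} [Field k] [CommRing R] [Algebra k R]
    (𝒜 : ℤ → Submodule k R) (N : GrComplex.{u, w} R) : GrComplex.{u, max u w} R where
  carrier := (ResBasis 𝒜 →₀ R) ⊗[R] N.carrier
  d := TensorProduct.map (resD 𝒜) LinearMap.id + TensorProduct.map (resSign 𝒜) N.d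
  gr n j := AddSubgroup.closure {z | ∃ (p q a b : ℤ) (x : ResBasis 𝒜 →₀ R) (m : N.carrier),
    p + q = n ∧ a + b = j ∧ x ∈ resGr 𝒜 p a ∧ m ∈ N.gr q b ∧ z = x ⊗ₜ[R] m}

/-! ## Regularity over a homomorphism -/

/-- `xs` is a minimal system of generators of `𝔫^c` modulo `𝔪S`, where `𝔪` and `𝔫` are the
graded maximal ideals of `R` and `S`, and consists of elements of degree `e`. -/
def IsMinimalSystem {k : Type u₁} {l : Type v₁} {R : Type u} {S : Type v} [Field k] [Field l]
    [CommRing R] [CommRing S] [Algebra k R] [Algebra l S]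
    (𝒜 : ℤ → Submodule k R) (𝒮 : ℤ → Submodule l S) (φ : R →+* S) (c : ℕ) (e : ℤ)
    (xs : List S) : Prop :=
  (∀ x ∈ xs, x ∈ 𝒮 e) ∧
  Ideal.span {x | x ∈ xs} ⊔ (irrelevantIdeal 𝒜).map φ = irrelevantIdeal 𝒮 ^ c ∧
  ∀ ys : List S, ys.Sublist xs →
    Ideal.span {x | x ∈ ys} ⊔ (irrelevantIdeal 𝒜).map φ = irrelevantIdeal 𝒮 ^ c → ys = xs

/-- The graded module `H_i(k ⊗ᴸ_{R^{(1/d)}} K[xs; M])` in degree `j`, for a homomorphism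
`φ : R → S` of order `d`, with `R` generated in degree `g`. Its dimension over the residue field
of `S` is the `(i, j)` graded Betti number of `M` over `φ`. -/
abbrev bettiSpace {k : Type u₁} {R : Type u} {S : Type v} [Field k] [CommRing R] [CommRing S]
    [Algebra k R] (𝒜 : ℤ → Submodule k R) (φ : R →+* S) (d g : ℕ) (xs : List S)
    (M : GrComplex.{v, w} S) (i j : ℤ) : Type (max u w) :=
  (derivedTensorResidue (fracGrading d 𝒜) ((M.koszul (d * g) xs).restrict φ)).homologyGr i j

/-- The regularity of `M` over `φ`, computed from the minimal system of generators `xs`: the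
supremum of `(j - idg)/(dg)` over all `i`, `j` for which the `(i, j)` Betti number is nonzero
(it is `-∞` if there are none). -/
def regOver {k : Type u₁} {R : Type u} {S : Type v} [Field k] [CommRing R] [CommRing S]
    [Algebra k R] (𝒜 : ℤ → Submodule k R) (φ : R →+* S) (d g : ℕ) (xs : List S)
    (M : GrComplex.{v, w} S) : EReal :=
  sSup {r | ∃ i j : ℤ, Nontrivial (bettiSpace 𝒜 φ d g xs M i j) ∧
    r = ((((j : ℝ) - i * (d * g)) / (d * g) : ℝ) : EReal)}

end

/-! The regularity depends only on the set of integers `j - i * e`, with `e = dg`, for which the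
`(i, j)` Betti number is nonzero (`bettiShifts`). Everything reduces to two facts about this set: it
does not depend on the chosen generators, and it changes in a controlled way under regrading.

Independence of generators: let `y` have degree `e` and lie in the ideal generated by `xs` and `𝔪S`.
Adding `y` to the sequence replaces the complex by the mapping cone of `y`. Each member of `xs` is
null-homotopic on the Koszul complex (`GrComplex.exists_koszul_homotopy`), and each positive
homogeneous element of `R` is null-homotopic on the resolution of `k` (`resD_resHomotopyTotal`).
Hence `y` acts as zero on homology (`killsHomology_of_mem_span`), and the homology of the cone is
nonzero exactly where the old homology or its shift by `(1, e)` is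
(`GrComplex.hasHomology_cone_iff`). That shift fixes `j - i * e`. Two systems of generators are then
both compared with their concatenation (`bettiShifts_eq`).

Regrading: the resolution has one basis element for each nonzero homogeneous cycle with its degree,
so multiplying all degrees by `t` gives the same resolution with degrees multiplied by `t`
(`resStepFrac`). For (i), all Betti degrees and the number `dg` are multiplied by `t`, and the
quotients do not change. For (ii), the derived tensor product over `R` of the Veronese regrading is
the one over `R^{(1/d)}` with each block of `d` consecutive degrees collected into one, so a Betti
number in degree `u` is nonzero exactly when one in degree `d * u + r` is, for some `0 ≤ r < d`
(`bettiNonzero_veronese_iff`). Since `(d * u + r) - i * (d * g) = d * (u - i * g) + r`, the two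
regularities differ by at most `(d - 1) / (d * g)`, in the stated direction. It remains that
generators over `S^{(d)}` also generate `𝔫^c` modulo `𝔪S`; this holds because `S_{dg} = S_{hc}`
consists of sums of products of `c` elements of degree `h`, and similarly in the Veronese ring. -/

noncomputable section

namespace GrComplex

/-! ## Nonvanishing homology -/

/-- There is a cycle of homological degree `i` and degree `j` that is not a boundary. -/
def HasHomology {S : Type v} [CommRing S] (M : GrComplex.{v, w} S) (i j : ℤ) : Prop :=
  ∃ z ∈ M.gr i j, M.d z = 0 ∧ ∀ x ∈ M.gr (i + 1) j, M.d x ≠ z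

theorem nontrivial_homologyGr_iff {S : Type v} [CommRing S] (M : GrComplex.{v, w} S) (i j : ℤ) :
    Nontrivial (M.homologyGr i j) ↔ M.HasHomology i j := by
  rw [← not_subsingleton_iff_nontrivial, QuotientAddGroup.subsingleton_iff,
    AddSubgroup.addSubgroupOf_eq_top, SetLike.not_le_iff_exists]
  constructor
  · rintro ⟨z, hz, hn⟩
    exact ⟨z, hz.2, hz.1, fun x hx h => hn ⟨x, hx, h⟩⟩
  · rintro ⟨z, hz, h0, hn⟩
    exact ⟨z, ⟨h0, hz⟩, fun ⟨x, hx, h⟩ => hn x hx h⟩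

/-- An isomorphism of complexes compatible with the bigradings. -/
structure GrEquiv {S : Type v} [CommRing S] (M M' : GrComplex.{v, w} S) where
  equiv : M.carrier ≃ₗ[S] M'.carrier
  map_d : ∀ m, equiv (M.d m) = M'.d (equiv m)
  mem : ∀ i j m, m ∈ M.gr i j → equiv m ∈ M'.gr i j
  symm_mem : ∀ i j m, m ∈ M'.gr i j → equiv.symm m ∈ M.gr i j

namespace GrEquiv

variable {S : Type v} [CommRing S] {M M' M'' : GrComplex.{v, w} S}

/-- The identity isomorphism. -/
def refl (M : GrComplex.{v, w} S) : GrEquiv M M :=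
  ⟨.refl S _, fun _ => rfl, fun _ _ _ h => h, fun _ _ _ h => h⟩

theorem symm_map_d (f : GrEquiv M M') (m : M'.carrier) :
    f.equiv.symm (M'.d m) = M.d (f.equiv.symm m) := by
  rw [LinearEquiv.symm_apply_eq, f.map_d, LinearEquiv.apply_symm_apply]

/-- The inverse isomorphism. -/
def symm (f : GrEquiv M M') : GrEquiv M' M :=
  ⟨f.equiv.symm, f.symm_map_d, f.symm_mem, fun i j m h => by simpa using f.mem i j m h⟩

/-- The composite isomorphism. -/
def trans (f : GrEquiv M M') (g : GrEquiv M' M'') : GrEquiv M M'' where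
  equiv := f.equiv.trans g.equiv
  map_d m := by simp [f.map_d, g.map_d]
  mem i j m h := g.mem _ _ _ (f.mem _ _ _ h)
  symm_mem i j m h := f.symm_mem _ _ _ (g.symm_mem _ _ _ h)

theorem hasHomology (f : GrEquiv M M') {i j : ℤ} (h : M.HasHomology i j) :
    M'.HasHomology i j := by
  obtain ⟨z, hz, h0, hn⟩ := h
  refine ⟨f.equiv z, f.mem _ _ _ hz, by rw [← f.map_d, h0, map_zero], fun x hx h => ?_⟩
  exact hn _ (f.symm_mem _ _ _ hx) (by rw [← f.symm_map_d, h, LinearEquiv.symm_apply_apply])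

theorem hasHomology_iff (f : GrEquiv M M') (i j : ℤ) :
    M.HasHomology i j ↔ M'.HasHomology i j :=
  ⟨f.hasHomology, f.symm.hasHomology⟩

/-- Isomorphic complexes have isomorphic Koszul complexes. -/
def koszulOne (f : GrEquiv M M') (e : ℤ) (x : S) :
    GrEquiv (M.koszulOne e x) (M'.koszulOne e x) where
  equiv := f.equiv.prodCongr f.equiv
  map_d m := Prod.ext
    (show f.equiv (M.d m.1 + x • m.2) = M'.d (f.equiv m.1) + x • f.equiv m.2 by
      rw [map_add, map_smul, f.map_d])
    (show f.equiv (-(M.d m.2)) = -(M'.d (f.equiv m.2)) by rw [map_neg, f.map_d])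
  mem i j m h := ⟨f.mem _ _ _ h.1, f.mem _ _ _ h.2⟩
  symm_mem i j m h := ⟨f.symm_mem _ _ _ h.1, f.symm_mem _ _ _ h.2⟩

/-- Two consecutive Koszul constructions commute. -/
def koszulOneSwap (M : GrComplex.{v, w} S) (e : ℤ) (x y : S) :
    GrEquiv ((M.koszulOne e y).koszulOne e x) ((M.koszulOne e x).koszulOne e y) where
  equiv :=
    -- The sign on the last component comes from the anticommutation of the two exterior generators.
    { toFun := fun m : (M.carrier × M.carrier) × (M.carrier × M.carrier) =>
        (((m.1.1, m.2.1), (m.1.2, -m.2.2)) :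
          (M.carrier × M.carrier) × (M.carrier × M.carrier))
      invFun := fun m : (M.carrier × M.carrier) × (M.carrier × M.carrier) =>
        (((m.1.1, m.2.1), (m.1.2, -m.2.2)) :
          (M.carrier × M.carrier) × (M.carrier × M.carrier))
      map_add' := fun m m' => Prod.ext rfl (Prod.ext rfl (neg_add _ _))
      map_smul' := fun s m => Prod.ext rfl (Prod.ext rfl (smul_neg s m.2.2).symm)
      left_inv := fun m => Prod.ext rfl (Prod.ext rfl (neg_neg _))
      right_inv := fun m => Prod.ext rfl (Prod.ext rfl (neg_neg _)) }
  map_d := by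
    rintro ⟨⟨a, b⟩, c, f⟩
    refine Prod.ext (Prod.ext ?_ ?_) (Prod.ext ?_ ?_)
    · change M.d a + y • b + x • c = M.d a + x • c + y • b
      abel
    · change -(M.d c + y • f) = -(M.d c) + y • (-f)
      rw [smul_neg, neg_add]
    · change -(M.d b) + x • f = -(M.d b + x • (-f))
      rw [smul_neg, neg_add, neg_neg]
    · change -(- -(M.d f)) = -(-(M.d (-f)))
      rw [map_neg]
  mem i j m h := ⟨⟨h.1.1, h.2.1⟩, h.1.2, (M.gr _ _).neg_mem h.2.2⟩
  symm_mem i j m h := ⟨⟨h.1.1, h.2.1⟩, h.1.2, (M.gr _ _).neg_mem h.2.2⟩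

end GrEquiv

/-- The Koszul complex does not depend on the order of the sequence. -/
theorem nonempty_grEquiv_koszul_of_perm {S : Type v} [CommRing S] (M : GrComplex.{v, w} S) (e : ℤ)
    {xs ys : List S} (h : xs.Perm ys) : Nonempty (GrEquiv (M.koszul e xs) (M.koszul e ys)) := by
  induction h with
  | nil => exact ⟨.refl _⟩
  | cons x _ ih => exact ih.map fun f => f.koszulOne e x
  | swap x y l => exact ⟨GrEquiv.koszulOneSwap _ e y x⟩
  | trans _ _ h₁ h₂ => exact h₁.elim fun f => h₂.map f.trans

/-! ## Mapping cones -/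

/-- The mapping cone of an endomorphism `y` of degree `e`. -/
def cone {S : Type v} [CommRing S] (M : GrComplex.{v, w} S) (e : ℤ)
    (y : M.carrier →ₗ[S] M.carrier) : GrComplex.{v, w} S where
  carrier := M.carrier × M.carrier
  d := LinearMap.prod
    (M.d ∘ₗ LinearMap.fst S M.carrier M.carrier + y ∘ₗ LinearMap.snd S M.carrier M.carrier)
    (-(M.d ∘ₗ LinearMap.snd S M.carrier M.carrier))
  gr i j := (M.gr i j).prod (M.gr (i - 1) (j - e))

/-- The endomorphism `y` maps cycles of degree `(i, j)` to boundaries of degree `(i, j + e)`. -/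
def KillsHomology {S : Type v} [CommRing S] (M : GrComplex.{v, w} S) (e : ℤ)
    (y : M.carrier →ₗ[S] M.carrier) : Prop :=
  ∀ i j, ∀ z ∈ M.gr i j, M.d z = 0 → ∃ x ∈ M.gr (i + 1) (j + e), M.d x = y z

/-- The long exact sequence of the cone breaks into short exact ones, since the connecting map is
induced by `y` and vanishes. The argument is carried out on elements, so no quotients occur. -/
theorem hasHomology_cone_iff {S : Type v} [CommRing S] (M : GrComplex.{v, w} S) (e : ℤ)
    (y : M.carrier →ₗ[S] M.carrier) (hd : ∀ m, y (M.d m) = M.d (y m))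
    (hy : ∀ i j, ∀ m ∈ M.gr i j, y m ∈ M.gr i (j + e)) (hk : M.KillsHomology e y) (i j : ℤ) :
    (M.cone e y).HasHomology i j ↔ M.HasHomology i j ∨ M.HasHomology (i - 1) (j - e) := by
  constructor
  · intro h
    by_contra hn
    rw [not_or] at hn
    obtain ⟨⟨a, b⟩, ⟨ha, hb⟩, h0, hbd⟩ := h
    have h1 : M.d a + y b = 0 := congrArg Prod.fst h0
    have h2 : -(M.d b) = 0 := congrArg Prod.snd h0
    simp only [HasHomology, not_exists, not_and, not_forall, not_not] at hn
    -- With `b = d c`, the element `a + y c` is a cycle; a primitive `x` of it makes `(x, -c)` a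
    -- primitive of `(a, b)`.
    obtain ⟨c, hc, hcb⟩ := hn.2 b hb (neg_eq_zero.1 h2)
    rw [sub_add_cancel] at hc
    have hyc := hy _ _ c hc
    rw [sub_add_cancel] at hyc
    obtain ⟨x, hx, hxe⟩ := hn.1 (a + y c) (add_mem ha hyc)
      (by rw [map_add, ← hd, hcb, h1])
    refine hbd (x, -c) ⟨hx, ?_⟩ (Prod.ext ?_ ?_)
    · change -c ∈ M.gr (i + 1 - 1) (j - e)
      rw [add_sub_cancel_right]
      exact neg_mem hc
    · change M.d x + y (-c) = a
      rw [hxe, map_neg, add_neg_cancel_right]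
    · change -(M.d (-c)) = b
      rw [map_neg, neg_neg, hcb]
  · rintro (⟨z, hz, h0, hn⟩ | ⟨b, hb, h0, hn⟩)
    · refine ⟨(z, 0), ⟨hz, zero_mem (M.gr _ _)⟩, Prod.ext ?_ ?_, ?_⟩
      · change M.d z + y 0 = 0
        rw [h0, map_zero, add_zero]
      · change -(M.d 0) = 0
        rw [map_zero, neg_zero]
      · rintro ⟨x, c⟩ ⟨hx, hc⟩ h
        have h1 : M.d x + y c = z := congrArg Prod.fst h
        have h2 : -(M.d c) = 0 := congrArg Prod.snd h
        -- As `c` is a cycle, `y c` is itself a boundary and can be absorbed into `x`.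
        obtain ⟨x', hx', h3⟩ := hk _ _ c hc (neg_eq_zero.1 h2)
        rw [sub_add_cancel, sub_add_cancel] at hx'
        exact hn (x + x') (add_mem hx hx') (by rw [map_add, h3, h1])
    · obtain ⟨x, hx, hxe⟩ := hk _ _ b hb h0
      rw [sub_add_cancel, sub_add_cancel] at hx
      refine ⟨(-x, b), ⟨(M.gr _ _).neg_mem hx, hb⟩, Prod.ext ?_ ?_, ?_⟩
      · change M.d (-x) + y b = 0
        rw [map_neg, hxe, neg_add_cancel]
      · change -(M.d b) = 0
        rw [h0, neg_zero]
      · rintro ⟨x', c⟩ ⟨_, hc⟩ h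
        have h2 : -(M.d c) = b := congrArg Prod.snd h
        have hc' : c ∈ M.gr (i + 1 - 1) (j - e) := hc
        rw [add_sub_cancel_right] at hc'
        refine hn (-c) ?_ (by rw [map_neg, h2])
        rw [sub_add_cancel]
        exact neg_mem hc'

/-- Multiplication by an element of `S` on the restriction of a complex along `R → S`. -/
def restrictSMul {R : Type u} {S : Type v} [CommRing R] [CommRing S] (φ : R →+* S)
    (M : GrComplex.{v, w} S) (s : S) :
    (M.restrict φ).carrier →ₗ[R] (M.restrict φ).carrier where
  toFun m := (s • (show M.carrier from m) : M.carrier)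
  map_add' m m' := smul_add (A := M.carrier) s m m'
  map_smul' r m := smul_comm (α := M.carrier) s (φ r) m

/-- Isomorphic complexes have isomorphic restrictions. -/
def GrEquiv.restrict {R : Type u} {S : Type v} [CommRing R] [CommRing S]
    {M M' : GrComplex.{v, w} S} (f : GrEquiv M M') (φ : R →+* S) :
    GrEquiv (M.restrict φ) (M'.restrict φ) where
  equiv :=
    { toFun := f.equiv
      invFun := f.equiv.symm
      map_add' := f.equiv.map_add
      map_smul' := fun r m => f.equiv.map_smul (φ r) m
      left_inv := f.equiv.left_inv
      right_inv := f.equiv.right_inv }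
  map_d := f.map_d
  mem := f.mem
  symm_mem := f.symm_mem

end GrComplex

/-! ## The graded resolution -/

section Resolution

variable {k : Type u₁} {R : Type u} [Field k] [CommRing R] [Algebra k R]
  {𝒜 ℬ : ℤ → Submodule k R}

theorem resSign_single (b : ResBasis 𝒜) (r : R) :
    resSign 𝒜 (Finsupp.single b r) = (-1) ^ b.1 • Finsupp.single b r := by
  simp [resSign, mul_comm]

theorem resSign_mapDomain (p : ℕ) (z : (resStep 𝒜 p).B →₀ R) :
    resSign 𝒜 (Finsupp.mapDomain (Sigma.mk p) z) =
      (-1) ^ p • Finsupp.mapDomain (Sigma.mk p) z := by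
  induction z using Finsupp.induction_linear with
  | zero => simp
  | add f g hf hg => rw [Finsupp.mapDomain_add, map_add, hf, hg, smul_add]
  | single b r => rw [Finsupp.mapDomain_single, resSign_single]

theorem resSign_resSign (x : ResBasis 𝒜 →₀ R) : resSign 𝒜 (resSign 𝒜 x) = x := by
  induction x using Finsupp.induction_linear with
  | zero => simp
  | add f g hf hg => rw [map_add, map_add, hf, hg]
  | single b r =>
    rw [resSign_single, map_zsmul, resSign_single, smul_smul, ← mul_pow]
    simp

theorem resD_single (b : ResBasis 𝒜) (r : R) :
    resD 𝒜 (Finsupp.single b r) = r • resDBasis 𝒜 b := by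
  simp [resD]

theorem resSign_resD (x : ResBasis 𝒜 →₀ R) :
    resSign 𝒜 (resD 𝒜 x) = -resD 𝒜 (resSign 𝒜 x) := by
  induction x using Finsupp.induction_linear with
  | zero => simp
  | add f g hf hg => rw [map_add, map_add, hf, hg, map_add, map_add, neg_add]
  | single b r =>
    rw [resSign_single, map_zsmul, resD_single, map_smul]
    obtain ⟨_ | p, b⟩ := b
    · simp [resDBasis]
    · change r • resSign 𝒜 (Finsupp.mapDomain (Sigma.mk p) b.1.2) =
        -((-1) ^ (p + 1) • r • Finsupp.mapDomain (Sigma.mk p) b.1.2)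
      rw [resSign_mapDomain, pow_succ, mul_neg_one, neg_smul, neg_neg, smul_comm]

theorem mapDomain_mem_resGr {p : ℕ} {e : ℤ} {z : (resStep 𝒜 p).B →₀ R}
    (hz : ∀ c, z c ∈ 𝒜 (e - (resStep 𝒜 p).deg c)) :
    Finsupp.mapDomain (Sigma.mk p) z ∈ resGr 𝒜 p e := by
  rintro ⟨q, c⟩
  by_cases h : q = p
  · subst h
    rw [Finsupp.mapDomain_apply sigma_mk_injective]
    exact ⟨hz c, fun h => (h rfl).elim⟩
  · rw [Finsupp.mapDomain_of_notMem_range]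
    · exact ⟨zero_mem _, fun _ => rfl⟩
    · rintro ⟨c', hc'⟩
      exact h (congrArg Sigma.fst hc').symm

theorem single_mem_resGr {b : ResBasis 𝒜} {r : R} {a : ℤ} (hr : r ∈ 𝒜 a) :
    Finsupp.single b r ∈ resGr 𝒜 b.1 (a + (resStep 𝒜 b.1).deg b.2) := by
  intro c
  by_cases h : b = c
  · subst h
    rw [Finsupp.single_eq_same]
    exact ⟨by simpa using hr, fun h => (h rfl).elim⟩
  · rw [Finsupp.single_eq_of_ne' h]
    exact ⟨zero_mem _, fun _ => rfl⟩

theorem smul_mem_resGr [SetLike.GradedMonoid 𝒜] {r : R} {a p e : ℤ} {x : ResBasis 𝒜 →₀ R}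
    (hr : r ∈ 𝒜 a) (hx : x ∈ resGr 𝒜 p e) : r • x ∈ resGr 𝒜 p (a + e) := by
  intro c
  refine ⟨?_, fun h => by rw [Finsupp.smul_apply, (hx c).2 h, smul_zero]⟩
  rw [add_sub_assoc]
  exact SetLike.GradedMul.mul_mem hr (hx c).1

/-- A linear map is homogeneous once it is so on the basis; this serves the differential, the sign
and the homotopy alike. -/
theorem linearCombination_mem_resGr [SetLike.GradedMonoid 𝒜]
    {v : ResBasis 𝒜 → (ResBasis 𝒜 →₀ R)} {p₀ a₀ : ℤ}
    (hv : ∀ b, v b ∈ resGr 𝒜 (b.1 + p₀) ((resStep 𝒜 b.1).deg b.2 + a₀)) (p a : ℤ)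
    (x : ResBasis 𝒜 →₀ R) (hx : x ∈ resGr 𝒜 p a) :
    Finsupp.linearCombination R v x ∈ resGr 𝒜 (p + p₀) (a + a₀) := by
  rw [Finsupp.linearCombination_apply]
  refine AddSubgroup.sum_mem _ fun b _ => ?_
  by_cases h : (b.1 : ℤ) = p
  · have := smul_mem_resGr (hx b).1 (hv b)
    rwa [h, ← add_assoc, sub_add_cancel] at this
  · simp only [(hx b).2 h, zero_smul]
    exact zero_mem _

theorem resD_mem_resGr [SetLike.GradedMonoid 𝒜] (p a : ℤ) (x : ResBasis 𝒜 →₀ R)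
    (hx : x ∈ resGr 𝒜 p a) : resD 𝒜 x ∈ resGr 𝒜 (p + -1) (a + 0) := by
  refine linearCombination_mem_resGr ?_ p a x hx
  rintro ⟨_ | p, b⟩
  · exact zero_mem (resGr 𝒜 _ _)
  · have := mapDomain_mem_resGr (𝒜 := 𝒜) b.2.2.2
    have h : ((p + 1 : ℕ) : ℤ) + -1 = p := by push_cast; ring
    change Finsupp.mapDomain (Sigma.mk p) b.1.2 ∈ resGr 𝒜 (((p + 1 : ℕ) : ℤ) + -1) (b.1.1 + 0)
    rwa [h, add_zero]

theorem resSign_mem_resGr [SetLike.GradedMonoid 𝒜] (p a : ℤ) (x : ResBasis 𝒜 →₀ R)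
    (hx : x ∈ resGr 𝒜 p a) : resSign 𝒜 x ∈ resGr 𝒜 (p + 0) (a + 0) := by
  refine linearCombination_mem_resGr (fun b => ?_) p a x hx
  have h1 : (1 : R) ∈ 𝒜 0 := SetLike.GradedOne.one_mem
  have : ((-1 : R) ^ b.1) ∈ 𝒜 0 := by
    rcases neg_one_pow_eq_or R b.1 with h | h <;> rw [h]
    · exact h1
    · exact neg_mem h1
  have := single_mem_resGr (b := b) this
  rwa [zero_add, ← add_zero ((b.1 : ℤ)), ← add_zero ((resStep 𝒜 b.1).deg b.2)] at this

end Resolution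

/-! ## Tensor products with a direct square -/

section TensorSquare

variable {R : Type*} {G A : Type*} [CommRing R] [AddCommGroup G] [AddCommGroup A] [Module R G]
  [Module R A]

/-- The isomorphism of `G ⊗ (A × A)` with `(G ⊗ A) × (G ⊗ A)` that is twisted on the second
component by an involution `σ` of `G`. -/
def tensorSquareEquiv (σ : G →ₗ[R] G) (hσ : ∀ x, σ (σ x) = x) :
    G ⊗[R] (A × A) ≃ₗ[R] (G ⊗[R] A) × (G ⊗[R] A) :=
  LinearEquiv.ofLinearMap
    (LinearMap.prod
      (TensorProduct.map LinearMap.id (LinearMap.fst R A A))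
      (TensorProduct.map σ (LinearMap.snd R A A)))
    (LinearMap.coprod
      (TensorProduct.map LinearMap.id (LinearMap.inl R A A))
      (TensorProduct.map σ (LinearMap.inr R A A)))
    (by
      refine LinearMap.prod_ext (TensorProduct.ext' fun x m => ?_)
        (TensorProduct.ext' fun x m => ?_)
      · simp
      · simp [hσ])
    (TensorProduct.ext' fun x m => by
      simp [hσ, ← TensorProduct.tmul_add])

/-- The total differential of the tensor product of `(G, δ)` and `(A, d)`, with signs given
by `σ`. -/
def tensorTotal (δ σ : G →ₗ[R] G) (d : A →ₗ[R] A) : G ⊗[R] A →ₗ[R] G ⊗[R] A :=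
  TensorProduct.map δ LinearMap.id + TensorProduct.map σ d

theorem tensorTotal_tmul (δ σ : G →ₗ[R] G) (d : A →ₗ[R] A) (x : G) (m : A) :
    tensorTotal δ σ d (x ⊗ₜ m) = δ x ⊗ₜ m + σ x ⊗ₜ d m := rfl

/-- The total differential carries `σ ⊗ y`; the twist by `σ` on the second component turns it into
the plain `id ⊗ y` of the cone. -/
theorem map_fst_tensor_cone (δ σ : G →ₗ[R] G) (d y : A →ₗ[R] A) (z : G ⊗[R] (A × A)) :
    TensorProduct.map LinearMap.id (LinearMap.fst R A A)
      (tensorTotal δ σ (LinearMap.prod (d ∘ₗ LinearMap.fst R A A + y ∘ₗ LinearMap.snd R A A)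
        (-(d ∘ₗ LinearMap.snd R A A))) z) =
    tensorTotal δ σ d
        (TensorProduct.map LinearMap.id (LinearMap.fst R A A) z) +
      TensorProduct.map LinearMap.id y (TensorProduct.map σ (LinearMap.snd R A A) z) := by
  induction z using TensorProduct.induction_on with
  | zero => simp
  | add a b ha hb => simp only [map_add, ha, hb]; abel
  | tmul x m => simp [tensorTotal_tmul, TensorProduct.tmul_add, add_assoc]

/-- Moving `σ` past `δ` gives one minus sign, and the cone contributes the other through `-d`, so
both terms of the total differential are negated together. -/
theorem map_snd_tensor_cone (δ σ : G →ₗ[R] G) (hσ : ∀ x, σ (δ x) = -δ (σ x)) (d y : A →ₗ[R] A)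
    (z : G ⊗[R] (A × A)) :
    TensorProduct.map σ (LinearMap.snd R A A)
      (tensorTotal δ σ (LinearMap.prod (d ∘ₗ LinearMap.fst R A A + y ∘ₗ LinearMap.snd R A A)
        (-(d ∘ₗ LinearMap.snd R A A))) z) =
    -tensorTotal δ σ d
        (TensorProduct.map σ (LinearMap.snd R A A) z) := by
  induction z using TensorProduct.induction_on with
  | zero => simp
  | add a b ha hb => simp only [map_add, ha, hb]; abel
  | tmul x m => simp [tensorTotal_tmul, hσ, TensorProduct.tmul_neg, TensorProduct.neg_tmul, add_comm]

end TensorSquare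

/-! ## The derived tensor product -/

section DerivedTensor

variable {k : Type u₁} {R : Type u} [Field k] [CommRing R] [Algebra k R]
  {𝒜 ℬ : ℤ → Submodule k R} {N N' : GrComplex.{u, w} R}

/-- The bigrading of the tensor product of the resolution with a bigraded module. -/
def tensorGrOf (𝒜 : ℤ → Submodule k R) {A : Type w} [AddCommGroup A] [Module R A]
    (gr : ℤ → ℤ → AddSubgroup A) (n j : ℤ) : AddSubgroup ((ResBasis 𝒜 →₀ R) ⊗[R] A) :=
  AddSubgroup.closure {z | ∃ (p q a b : ℤ) (x : ResBasis 𝒜 →₀ R) (m : A),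
    p + q = n ∧ a + b = j ∧ x ∈ resGr 𝒜 p a ∧ m ∈ gr q b ∧ z = x ⊗ₜ[R] m}

theorem tmul_mem_tensorGrOf {p q a b n j : ℤ} {A : Type w} [AddCommGroup A]
    [Module R A] {gr : ℤ → ℤ → AddSubgroup A} {x : ResBasis 𝒜 →₀ R} {m : A}
    (hx : x ∈ resGr 𝒜 p a) (hm : m ∈ gr q b) (hn : p + q = n) (hj : a + b = j) :
    x ⊗ₜ[R] m ∈ tensorGrOf 𝒜 gr n j :=
  AddSubgroup.subset_closure ⟨p, q, a, b, x, m, hn, hj, hx, hm, rfl⟩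

/-- The bigrading of `derivedTensorResidue`. -/
def tensorGr (𝒜 : ℤ → Submodule k R) (N : GrComplex.{u, w} R) (n j : ℤ) :
    AddSubgroup ((ResBasis 𝒜 →₀ R) ⊗[R] N.carrier) :=
  tensorGrOf 𝒜 N.gr n j

/-- The differential of `derivedTensorResidue`. -/
def tensorD (𝒜 : ℤ → Submodule k R) (N : GrComplex.{u, w} R) :
    (ResBasis 𝒜 →₀ R) ⊗[R] N.carrier →ₗ[R] (ResBasis 𝒜 →₀ R) ⊗[R] N.carrier :=
  tensorTotal (resD 𝒜) (resSign 𝒜) N.d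

theorem tensorD_tmul (x : ResBasis 𝒜 →₀ R) (m : N.carrier) :
    tensorD 𝒜 N (x ⊗ₜ m) = resD 𝒜 x ⊗ₜ m + resSign 𝒜 x ⊗ₜ N.d m := rfl

theorem tmul_mem_tensorGr {p q a b n j : ℤ} {x : ResBasis 𝒜 →₀ R} {m : N.carrier}
    (hx : x ∈ resGr 𝒜 p a) (hm : m ∈ N.gr q b) (hn : p + q = n) (hj : a + b = j) :
    x ⊗ₜ[R] m ∈ tensorGr 𝒜 N n j :=
  tmul_mem_tensorGrOf hx hm hn hj

/-- The target bidegree is tied to the source by equations instead of being a fixed expression, so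
that sums and differences of degrees need no rewriting when the lemma is applied. -/
theorem map_mem_tensorGr {f : (ResBasis 𝒜 →₀ R) →ₗ[R] (ResBasis ℬ →₀ R)}
    {g : N.carrier →ₗ[R] N'.carrier} {p₀ a₀ q₀ b₀ : ℤ}
    (hf : ∀ p a, ∀ x ∈ resGr 𝒜 p a, f x ∈ resGr ℬ (p + p₀) (a + a₀))
    (hg : ∀ q b, ∀ m ∈ N.gr q b, g m ∈ N'.gr (q + q₀) (b + b₀)) {n j n' j' : ℤ}
    (hn : n + p₀ + q₀ = n') (hj : j + a₀ + b₀ = j') {z : (ResBasis 𝒜 →₀ R) ⊗[R] N.carrier}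
    (hz : z ∈ tensorGr 𝒜 N n j) : TensorProduct.map f g z ∈ tensorGr ℬ N' n' j' := by
  induction hz using AddSubgroup.closure_induction with
  | mem z hz =>
    obtain ⟨p, q, a, b, x, m, rfl, rfl, hx, hm, rfl⟩ := hz
    exact tmul_mem_tensorGr (hf p a x hx) (hg q b m hm) (by rw [← hn]; ring) (by rw [← hj]; ring)
  | zero => rw [map_zero]; exact zero_mem _
  | add y z _ _ hy hz => rw [map_add]; exact add_mem hy hz
  | neg z _ hz => rw [map_neg]; exact neg_mem hz

theorem id_mem_resGr (p a : ℤ) (x : ResBasis 𝒜 →₀ R) (hx : x ∈ resGr 𝒜 p a) :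
    (LinearMap.id : (ResBasis 𝒜 →₀ R) →ₗ[R] _) x ∈ resGr 𝒜 (p + 0) (a + 0) := by
  rwa [add_zero, add_zero]

theorem tensorD_mem_tensorGr [SetLike.GradedMonoid 𝒜]
    (hd : ∀ i j, ∀ m ∈ N.gr i j, N.d m ∈ N.gr (i - 1) j) {n j : ℤ}
    {z : (ResBasis 𝒜 →₀ R) ⊗[R] N.carrier} (hz : z ∈ tensorGr 𝒜 N n j) :
    tensorD 𝒜 N z ∈ tensorGr 𝒜 N (n - 1) j := by
  refine add_mem
    (map_mem_tensorGr (q₀ := 0) (b₀ := 0) resD_mem_resGr (fun q b m hm => ?_) (by ring)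
      (by ring) hz)
    (map_mem_tensorGr (q₀ := -1) (b₀ := 0) resSign_mem_resGr (fun q b m hm => ?_) (by ring)
      (by ring) hz)
  · rwa [add_zero, add_zero]
  · rw [add_zero]
    exact hd q b m hm

/-- The derived tensor product preserves isomorphisms. -/
def GrComplex.GrEquiv.derivedTensor (f : GrComplex.GrEquiv N N') (𝒜 : ℤ → Submodule k R) :
    GrComplex.GrEquiv (derivedTensorResidue 𝒜 N) (derivedTensorResidue 𝒜 N') where
  equiv := TensorProduct.congr (.refl R _) f.equiv
  map_d z := by
    change TensorProduct.map LinearMap.id f.equiv.toLinearMap (tensorD 𝒜 N z) =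
      tensorD 𝒜 N' (TensorProduct.map LinearMap.id f.equiv.toLinearMap z)
    induction z using TensorProduct.induction_on with
    | zero => simp
    | add x y hx hy => rw [map_add, map_add, hx, hy, map_add, map_add]
    | tmul x m => simp [tensorD_tmul, f.map_d]
  mem i j z hz := map_mem_tensorGr (f := LinearMap.id) (g := f.equiv.toLinearMap)
    (q₀ := 0) (b₀ := 0) id_mem_resGr
    (fun q b m hm => by simpa using f.mem q b m hm) (by ring) (by ring) hz
  symm_mem i j z hz := map_mem_tensorGr (f := LinearMap.id) (g := f.equiv.symm.toLinearMap)
    (q₀ := 0) (b₀ := 0) id_mem_resGr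
    (fun q b m hm => by simpa using f.symm_mem q b m hm) (by ring) (by ring) hz

/-- The derived tensor product commutes with mapping cones. -/
def derivedTensorCone (𝒜 : ℤ → Submodule k R) [SetLike.GradedMonoid 𝒜] (N : GrComplex.{u, w} R)
    (e : ℤ) (y : N.carrier →ₗ[R] N.carrier) :
    GrComplex.GrEquiv (derivedTensorResidue 𝒜 (N.cone e y))
      ((derivedTensorResidue 𝒜 N).cone e (TensorProduct.map LinearMap.id y)) where
  equiv := tensorSquareEquiv (A := N.carrier) (resSign 𝒜) resSign_resSign
  map_d z := Prod.ext
    (map_fst_tensor_cone (A := N.carrier) (resD 𝒜) (resSign 𝒜) N.d y z)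
    (map_snd_tensor_cone (A := N.carrier) (resD 𝒜) (resSign 𝒜) resSign_resD N.d y z)
  mem i j z hz := by
    have h₁ : TensorProduct.map LinearMap.id (LinearMap.fst R N.carrier N.carrier) z ∈
        tensorGr 𝒜 N i j :=
      map_mem_tensorGr (N := N.cone e y) (f := LinearMap.id)
        (g := LinearMap.fst R N.carrier N.carrier) (q₀ := 0) (b₀ := 0) id_mem_resGr
        (fun q b m hm => by rw [add_zero, add_zero]; exact hm.1) (by ring) (by ring) hz
    have h₂ : TensorProduct.map (resSign 𝒜) (LinearMap.snd R N.carrier N.carrier) z ∈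
        tensorGr 𝒜 N (i - 1) (j - e) :=
      map_mem_tensorGr (N := N.cone e y) (f := resSign 𝒜)
        (g := LinearMap.snd R N.carrier N.carrier) (q₀ := -1) (b₀ := -e) resSign_mem_resGr
        (fun q b m hm => hm.2) (by ring) (by ring) hz
    exact ⟨h₁, h₂⟩
  symm_mem i j z hz := by
    have h₁ : TensorProduct.map LinearMap.id (LinearMap.inl R N.carrier N.carrier) z.1 ∈
        tensorGr 𝒜 (N.cone e y) i j :=
      map_mem_tensorGr (N' := N.cone e y) (f := LinearMap.id)
        (g := LinearMap.inl R N.carrier N.carrier) (q₀ := 0) (b₀ := 0) id_mem_resGr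
        (fun q b m hm => by rw [add_zero, add_zero]; exact ⟨hm, zero_mem (N.gr _ _)⟩)
        (by ring) (by ring) hz.1
    have h₂ : TensorProduct.map (resSign 𝒜) (LinearMap.inr R N.carrier N.carrier) z.2 ∈
        tensorGr 𝒜 (N.cone e y) i j :=
      map_mem_tensorGr (N' := N.cone e y) (f := resSign 𝒜)
        (g := LinearMap.inr R N.carrier N.carrier) (q₀ := 1) (b₀ := e) resSign_mem_resGr
        (fun q b m hm => ⟨zero_mem (N.gr _ _), by
          change m ∈ N.gr (q + 1 - 1) (b + e - e)
          rwa [add_sub_cancel_right, add_sub_cancel_right]⟩) (by ring) (by ring) hz.2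
    exact add_mem h₁ h₂

end DerivedTensor

/-! ## Null-homotopies -/

section TensorHomotopy

variable {R : Type*} {G A : Type*} [CommRing R] [AddCommGroup G] [AddCommGroup A] [Module R G]
  [Module R A]

/-- The cross terms `σ (η x) ⊗ d m` and `η (σ x) ⊗ d m` cancel because `η` is odd with respect to
`σ`. -/
theorem tensorTotal_homotopy_left {δ σ η : G →ₗ[R] G} {r : R} (d : A →ₗ[R] A)
    (h : ∀ x, δ (η x) + η (δ x) = r • x) (hσ : ∀ x, σ (η x) = -η (σ x)) (z : G ⊗[R] A) :
    tensorTotal δ σ d (TensorProduct.map η LinearMap.id z) +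
      TensorProduct.map η LinearMap.id (tensorTotal δ σ d z) = r • z := by
  induction z using TensorProduct.induction_on with
  | zero => simp
  | add a b ha hb => rw [smul_add, ← ha, ← hb]; simp only [map_add]; abel
  | tmul x m =>
    simp only [TensorProduct.map_tmul, tensorTotal_tmul, map_add, LinearMap.id_apply, hσ,
      TensorProduct.neg_tmul, TensorProduct.smul_tmul', ← h, TensorProduct.add_tmul]
    abel

/-- A homotopy on the second factor must pass the first one, hence `σ ⊗ η`. The cross terms cancel
by `σδ = -δσ`, and `σσ = 1` removes the sign from what remains. -/
theorem tensorTotal_homotopy_right {δ σ : G →ₗ[R] G} {d η y : A →ₗ[R] A}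
    (h : ∀ m, d (η m) + η (d m) = y m) (hσ : ∀ x, σ (δ x) = -δ (σ x)) (hσσ : ∀ x, σ (σ x) = x)
    (z : G ⊗[R] A) :
    tensorTotal δ σ d (TensorProduct.map σ η z) + TensorProduct.map σ η (tensorTotal δ σ d z) =
      TensorProduct.map LinearMap.id y z := by
  induction z using TensorProduct.induction_on with
  | zero => simp
  | add a b ha hb =>
    rw [map_add (TensorProduct.map LinearMap.id y), ← ha, ← hb]; simp only [map_add]; abel
  | tmul x m =>
    simp only [TensorProduct.map_tmul, tensorTotal_tmul, map_add, LinearMap.id_apply, hσ, hσσ,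
      TensorProduct.neg_tmul, ← h, TensorProduct.tmul_add]
    abel

theorem tensorTotal_map_id {δ σ : G →ₗ[R] G} {d y : A →ₗ[R] A} (h : ∀ m, y (d m) = d (y m))
    (z : G ⊗[R] A) :
    TensorProduct.map LinearMap.id y (tensorTotal δ σ d z) =
      tensorTotal δ σ d (TensorProduct.map LinearMap.id y z) := by
  induction z using TensorProduct.induction_on with
  | zero => simp
  | add a b ha hb => simp only [map_add, ha, hb]
  | tmul x m => simp [tensorTotal_tmul, h]

end TensorHomotopy

/-- Each member of the sequence acts null-homotopically on the Koszul complex. -/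
theorem GrComplex.exists_koszul_homotopy {S : Type v} [CommRing S] (M : GrComplex.{v, w} S) (e : ℤ)
    {xs : List S} {x : S} (hx : x ∈ xs) :
    ∃ η : (M.koszul e xs).carrier →ₗ[S] (M.koszul e xs).carrier,
      (∀ m, (M.koszul e xs).d (η m) + η ((M.koszul e xs).d m) = x • m) ∧
      ∀ i j, ∀ m ∈ (M.koszul e xs).gr i j, η m ∈ (M.koszul e xs).gr (i + 1) (j + e) := by
  induction hx with
  | head xs =>
    let K := M.koszul e xs
    -- Exterior multiplication by the generator belonging to `x`.
    refine ⟨LinearMap.inr S K.carrier K.carrier ∘ₗ LinearMap.fst S K.carrier K.carrier, ?_, ?_⟩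
    · rintro ⟨a, b⟩
      refine Prod.ext ?_ ?_
      · change K.d 0 + x • a + 0 = x • a
        rw [map_zero, zero_add, add_zero]
      · change -(K.d a) + (K.d a + x • b) = x • b
        rw [neg_add_cancel_left]
    · rintro i j ⟨a, b⟩ h
      refine ⟨zero_mem (K.gr _ _), ?_⟩
      change a ∈ K.gr (i + 1 - 1) (j + e - e)
      rw [add_sub_cancel_right, add_sub_cancel_right]
      exact h.1
  | @tail y xs _ ih =>
    obtain ⟨η, h₁, h₂⟩ := ih
    let K := M.koszul e xs
    change K.carrier →ₗ[S] K.carrier at η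
    change ∀ m : K.carrier, K.d (η m) + η (K.d m) = x • m at h₁
    change ∀ i j, ∀ m ∈ K.gr i j, η m ∈ K.gr (i + 1) (j + e) at h₂
    -- The sign on the second summand is needed because the Koszul differential sends `b` to `y • b`
    -- in the first summand and the cross terms have to cancel.
    refine ⟨LinearMap.prodMap η (-η), ?_, ?_⟩
    · rintro ⟨a, b⟩
      refine Prod.ext ?_ ?_
      · change K.d (η a) + y • (-η b) + η (K.d a + y • b) = x • a
        rw [← h₁, map_add, map_smul, smul_neg]
        abel
      · change -(K.d (-η b)) + -(η (-(K.d b))) = x • b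
        rw [← h₁, map_neg, map_neg, neg_neg, neg_neg]
    · rintro i j ⟨a, b⟩ h
      refine ⟨h₂ _ _ _ h.1, ?_⟩
      change -(η b) ∈ K.gr (i + 1 - 1) (j + e - e)
      have := h₂ _ _ _ h.2
      rw [sub_add_cancel, sub_add_cancel] at this
      rw [add_sub_cancel_right, add_sub_cancel_right]
      exact neg_mem this

/-! ### Contracting homotopies on the resolution for elements of the graded maximal ideal. -/

section ResolutionHomotopy

variable {k : Type u₁} {R : Type u} [Field k] [CommRing R] [Algebra k R]
  {𝒜 : ℤ → Submodule k R}

/-- The homogeneous cycle of step `p` that a basis element of step `p + 1` stands for. -/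
def resElt {p : ℕ} (b : (resStep 𝒜 (p + 1)).B) : (resStep 𝒜 p).B →₀ R := b.1.2

/-- The basis element of step `p + 1` given by a nonzero homogeneous cycle of step `p`. -/
def resMk {p : ℕ} (a : ℤ) (z : (resStep 𝒜 p).B →₀ R) (h : z ∈ (resStep 𝒜 p).Z ∧ z ≠ 0 ∧
    ∀ c, z c ∈ 𝒜 (a - (resStep 𝒜 p).deg c)) : (resStep 𝒜 (p + 1)).B := ⟨(a, z), h⟩

/-- The differential from step `p + 1` to step `p` of the resolution. -/
def resStepD (𝒜 : ℤ → Submodule k R) (p : ℕ) :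
    ((resStep 𝒜 (p + 1)).B →₀ R) →ₗ[R] ((resStep 𝒜 p).B →₀ R) :=
  Finsupp.linearCombination R resElt

theorem resStepD_single {p : ℕ} (b : (resStep 𝒜 (p + 1)).B) (r : R) :
    resStepD 𝒜 p (Finsupp.single b r) = r • resElt b :=
  Finsupp.linearCombination_single R r b

theorem mem_resStep_succ_iff {p : ℕ} {z : (resStep 𝒜 (p + 1)).B →₀ R} :
    z ∈ (resStep 𝒜 (p + 1)).Z ↔ resStepD 𝒜 p z = 0 := Iff.rfl

theorem resD_mapDomain_succ (p : ℕ) (z : (resStep 𝒜 (p + 1)).B →₀ R) :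
    resD 𝒜 (Finsupp.mapDomain (Sigma.mk (p + 1)) z) =
      Finsupp.mapDomain (Sigma.mk p) (resStepD 𝒜 p z) := by
  induction z using Finsupp.induction_linear with
  | zero => simp
  | add f g hf hg => rw [Finsupp.mapDomain_add, map_add, hf, hg, map_add, Finsupp.mapDomain_add]
  | single b r =>
    rw [Finsupp.mapDomain_single, resD_single, resStepD_single, Finsupp.mapDomain_smul]
    rfl

open Classical in
/-- A preimage of a homogeneous cycle of step `p`: a basis element of step `p + 1`, or zero. -/
def resLift (p : ℕ) (a : ℤ) (z : (resStep 𝒜 p).B →₀ R) : (resStep 𝒜 (p + 1)).B →₀ R :=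
  if h : z ∈ (resStep 𝒜 p).Z ∧ z ≠ 0 ∧ ∀ c, z c ∈ 𝒜 (a - (resStep 𝒜 p).deg c) then
    Finsupp.single (resMk a z h) 1
  else 0

/-- Every nonzero homogeneous cycle is the image of its own basis element, so lifting needs no
exactness argument and no choice. -/
theorem resStepD_resLift {p : ℕ} {a : ℤ} {z : (resStep 𝒜 p).B →₀ R} (hz : z ∈ (resStep 𝒜 p).Z)
    (ha : ∀ c, z c ∈ 𝒜 (a - (resStep 𝒜 p).deg c)) : resStepD 𝒜 p (resLift p a z) = z := by
  by_cases h0 : z = 0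
  · rw [resLift, dif_neg fun h => h.2.1 h0, map_zero, h0]
  · rw [resLift, dif_pos ⟨hz, h0, ha⟩, resStepD_single, one_smul]
    rfl

/-- The default value zero lies in every degree, so nothing is required of `z`. Homogeneity of the
homotopy can thus be proved before the homotopy identity. -/
theorem resLift_apply_mem [SetLike.GradedMonoid 𝒜] (p : ℕ) (a : ℤ) (z : (resStep 𝒜 p).B →₀ R)
    (c : (resStep 𝒜 (p + 1)).B) :
    resLift p a z c ∈ 𝒜 (a - (resStep 𝒜 (p + 1)).deg c) := by
  rw [resLift]
  split_ifs with h
  · by_cases hc : resMk a z h = c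
    · subst hc
      rw [Finsupp.single_eq_same]
      change (1 : R) ∈ 𝒜 (a - a)
      rw [sub_self]
      exact SetLike.GradedOne.one_mem
    · rw [Finsupp.single_eq_of_ne' hc]
      exact zero_mem _
  · exact zero_mem _

/-- A contraction of multiplication by the element `r` of degree `a` on the resolution. -/
def resHomotopy (𝒜 : ℤ → Submodule k R) (a : ℤ) (r : R) :
    (p : ℕ) → (resStep 𝒜 p).B → ((resStep 𝒜 (p + 1)).B →₀ R)
  | 0, b => resLift 0 a (Finsupp.single b r)
  | p + 1, b => resLift (p + 1) ((resStep 𝒜 (p + 1)).deg b + a)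
      (Finsupp.single b r - Finsupp.linearCombination R (resHomotopy 𝒜 a r p) (resElt b))

theorem resHomotopy_apply_mem [SetLike.GradedMonoid 𝒜] (a : ℤ) (r : R) (p : ℕ)
    (b : (resStep 𝒜 p).B) (c : (resStep 𝒜 (p + 1)).B) :
    resHomotopy 𝒜 a r p b c ∈ 𝒜 ((resStep 𝒜 p).deg b + a - (resStep 𝒜 (p + 1)).deg c) := by
  cases p with
  | zero =>
    change resLift 0 a (Finsupp.single b r) c ∈ 𝒜 (0 + a - _)
    rw [zero_add]
    exact resLift_apply_mem _ _ _ _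
  | succ p => exact resLift_apply_mem _ _ _ _

theorem linearCombination_resHomotopy_apply_mem [SetLike.GradedMonoid 𝒜] (a : ℤ) (r : R) {p : ℕ}
    {e : ℤ} {z : (resStep 𝒜 p).B →₀ R} (hz : ∀ c, z c ∈ 𝒜 (e - (resStep 𝒜 p).deg c))
    (c : (resStep 𝒜 (p + 1)).B) :
    (Finsupp.linearCombination R (resHomotopy 𝒜 a r p) z) c ∈
      𝒜 (e + a - (resStep 𝒜 (p + 1)).deg c) := by
  rw [Finsupp.linearCombination_apply, Finsupp.sum, Finsupp.finsetSum_apply]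
  refine sum_mem fun b _ => ?_
  have := SetLike.GradedMul.mul_mem (hz b) (resHomotopy_apply_mem a r p b c)
  rwa [← add_sub_assoc, ← add_assoc, sub_add_cancel] at this

theorem single_apply_mem {p : ℕ} {a : ℤ} {r : R} (hr : r ∈ 𝒜 a) (b c : (resStep 𝒜 p).B) :
    Finsupp.single b r c ∈ 𝒜 ((resStep 𝒜 p).deg b + a - (resStep 𝒜 p).deg c) := by
  by_cases h : b = c
  · subst h
    rwa [add_sub_cancel_left, Finsupp.single_eq_same]
  · rw [Finsupp.single_eq_of_ne' h]
    exact zero_mem _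

theorem resStepD_resHomotopy_zero {a : ℤ} {r : R} (hr : r ∈ 𝒜 a)
    (hm : r ∈ irrelevantIdeal 𝒜) (b : (resStep 𝒜 0).B) :
    resStepD 𝒜 0 (resHomotopy 𝒜 a r 0 b) = Finsupp.single b r := by
  refine resStepD_resLift ?_ fun c => ?_
  · change Finsupp.single b r PUnit.unit ∈ irrelevantIdeal 𝒜
    have h : Finsupp.single b r PUnit.unit = r := Finsupp.single_eq_same
    rwa [h]
  · have := single_apply_mem hr b c
    rwa [show (resStep 𝒜 0).deg b = 0 from rfl, zero_add] at this

theorem linearCombination_single_apply {ι : Type*} (r : R) (z : ι →₀ R) :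
    Finsupp.linearCombination R (fun b => Finsupp.single b r) z = r • z := by
  induction z using Finsupp.induction_linear with
  | zero => simp
  | add f g hf hg => rw [map_add, hf, hg, smul_add]
  | single b s => simp [mul_comm]

/-- The two claims feed each other. Writing `s` for the homotopy and `∂` for the differential, `∂s =
r` on cycles of step `p` makes `r • b - s (∂b)` a cycle, which is what `resLift` needs at step `p +
1`. The resulting identity `∂s = r - s∂` restricts to `∂s = r` on cycles of that step. -/
theorem resStepD_resHomotopy [SetLike.GradedMonoid 𝒜] {a : ℤ} {r : R} (hr : r ∈ 𝒜 a)
    (hm : r ∈ irrelevantIdeal 𝒜) (p : ℕ) :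
    (∀ z ∈ (resStep 𝒜 p).Z,
      resStepD 𝒜 p (Finsupp.linearCombination R (resHomotopy 𝒜 a r p) z) = r • z) ∧
    ∀ b : (resStep 𝒜 (p + 1)).B, resStepD 𝒜 (p + 1) (resHomotopy 𝒜 a r (p + 1) b) =
      Finsupp.single b r - Finsupp.linearCombination R (resHomotopy 𝒜 a r p) (resElt b) := by
  have step : ∀ p, (∀ z ∈ (resStep 𝒜 p).Z,
      resStepD 𝒜 p (Finsupp.linearCombination R (resHomotopy 𝒜 a r p) z) = r • z) →
    ∀ b : (resStep 𝒜 (p + 1)).B, resStepD 𝒜 (p + 1) (resHomotopy 𝒜 a r (p + 1) b) =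
      Finsupp.single b r - Finsupp.linearCombination R (resHomotopy 𝒜 a r p) (resElt b) := by
    intro p hp b
    refine resStepD_resLift ?_ fun c => ?_
    · rw [mem_resStep_succ_iff, map_sub, resStepD_single, hp (resElt b) b.2.1, sub_self]
    · exact sub_mem (single_apply_mem hr b c)
        (linearCombination_resHomotopy_apply_mem a r b.2.2.2 c)
  suffices h : ∀ z ∈ (resStep 𝒜 p).Z,
      resStepD 𝒜 p (Finsupp.linearCombination R (resHomotopy 𝒜 a r p) z) = r • z from
    ⟨h, step p h⟩
  induction p with
  | zero =>
    -- At step zero `r` maps all of `R` into `𝔪`, so the identity holds for every `z`.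
    intro z _
    rw [← LinearMap.comp_apply, ← linearCombination_single_apply]
    congr 1
    refine Finsupp.lhom_ext fun b s => ?_
    simp [resStepD_resHomotopy_zero hr hm]
  | succ p ih =>
    intro z hz
    have h : resStepD 𝒜 (p + 1) ∘ₗ Finsupp.linearCombination R (resHomotopy 𝒜 a r (p + 1)) =
        Finsupp.linearCombination R (fun b => Finsupp.single b r) -
          Finsupp.linearCombination R (resHomotopy 𝒜 a r p) ∘ₗ resStepD 𝒜 p := by
      refine Finsupp.lhom_ext fun b s => ?_
      simp only [LinearMap.comp_apply, LinearMap.sub_apply, Finsupp.linearCombination_single,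
        resStepD_single, map_smul, step p ih, smul_sub]
    rw [← LinearMap.comp_apply, h, LinearMap.sub_apply, LinearMap.comp_apply,
      mem_resStep_succ_iff.1 hz, map_zero, sub_zero, linearCombination_single_apply]

/-- The contraction `resHomotopy` on the whole resolution. -/
def resHomotopyTotal (𝒜 : ℤ → Submodule k R) (a : ℤ) (r : R) :
    (ResBasis 𝒜 →₀ R) →ₗ[R] (ResBasis 𝒜 →₀ R) :=
  Finsupp.linearCombination R fun b =>
    Finsupp.mapDomain (Sigma.mk (b.1 + 1)) (resHomotopy 𝒜 a r b.1 b.2)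

theorem resHomotopyTotal_single (a : ℤ) (r : R) (b : ResBasis 𝒜) (s : R) :
    resHomotopyTotal 𝒜 a r (Finsupp.single b s) =
      s • Finsupp.mapDomain (Sigma.mk (b.1 + 1)) (resHomotopy 𝒜 a r b.1 b.2) := by
  simp [resHomotopyTotal]

theorem resHomotopyTotal_mapDomain (a : ℤ) (r : R) (p : ℕ) (z : (resStep 𝒜 p).B →₀ R) :
    resHomotopyTotal 𝒜 a r (Finsupp.mapDomain (Sigma.mk p) z) =
      Finsupp.mapDomain (Sigma.mk (p + 1))
        (Finsupp.linearCombination R (resHomotopy 𝒜 a r p) z) := by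
  induction z using Finsupp.induction_linear with
  | zero => simp
  | add f g hf hg => rw [Finsupp.mapDomain_add, map_add, hf, hg, map_add, Finsupp.mapDomain_add]
  | single b s =>
    rw [Finsupp.mapDomain_single, resHomotopyTotal_single, Finsupp.linearCombination_single,
      Finsupp.mapDomain_smul]

theorem resHomotopyTotal_mem_resGr [SetLike.GradedMonoid 𝒜] (a₀ : ℤ) (r : R) (p a : ℤ)
    (x : ResBasis 𝒜 →₀ R) (hx : x ∈ resGr 𝒜 p a) :
    resHomotopyTotal 𝒜 a₀ r x ∈ resGr 𝒜 (p + 1) (a + a₀) := by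
  refine linearCombination_mem_resGr (fun b => ?_) p a x hx
  have := mapDomain_mem_resGr (resHomotopy_apply_mem a₀ r b.1 b.2)
  rwa [Nat.cast_add, Nat.cast_one] at this

theorem resSign_resHomotopyTotal (a : ℤ) (r : R) (x : ResBasis 𝒜 →₀ R) :
    resSign 𝒜 (resHomotopyTotal 𝒜 a r x) = -resHomotopyTotal 𝒜 a r (resSign 𝒜 x) := by
  induction x using Finsupp.induction_linear with
  | zero => simp
  | add f g hf hg => rw [map_add, map_add, hf, hg, map_add, map_add, neg_add]
  | single b s =>
    rw [resSign_single, map_zsmul, resHomotopyTotal_single, map_smul, resSign_mapDomain, pow_succ,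
      mul_neg_one, neg_smul, smul_neg, smul_comm]

theorem resD_resHomotopyTotal [SetLike.GradedMonoid 𝒜] {a : ℤ} {r : R} (hr : r ∈ 𝒜 a)
    (hm : r ∈ irrelevantIdeal 𝒜) (x : ResBasis 𝒜 →₀ R) :
    resD 𝒜 (resHomotopyTotal 𝒜 a r x) + resHomotopyTotal 𝒜 a r (resD 𝒜 x) = r • x := by
  induction x using Finsupp.induction_linear with
  | zero => simp
  | add f g hf hg => rw [smul_add, ← hf, ← hg]; simp only [map_add]; abel
  | single b s =>
    rw [resHomotopyTotal_single, resD_single, map_smul, map_smul, resD_mapDomain_succ, ← smul_add]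
    obtain ⟨_ | p, b⟩ := b
    · rw [resStepD_resHomotopy_zero hr hm, resDBasis, map_zero, add_zero,
        Finsupp.mapDomain_single, Finsupp.smul_single, Finsupp.smul_single, smul_eq_mul,
        smul_eq_mul, mul_comm]
    · rw [(resStepD_resHomotopy hr hm p).2,
        show resDBasis 𝒜 ⟨p + 1, b⟩ = Finsupp.mapDomain (Sigma.mk p) (resElt b) from rfl,
        resHomotopyTotal_mapDomain,
        ← Finsupp.mapDomain_add, sub_add_cancel,
        Finsupp.mapDomain_single, Finsupp.smul_single, Finsupp.smul_single, smul_eq_mul,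
        smul_eq_mul, mul_comm]

end ResolutionHomotopy

/-! ## Fractional gradings -/

section FracGrading

variable {k : Type u₁} {R : Type u} [Field k] [CommRing R] [Algebra k R]
  {𝒜 : ℤ → Submodule k R}

/-- The case `r = 0` is separate because zero lies in the degrees that `t` does not divide as well.
-/
theorem mem_fracGrading_iff {t : ℕ} (ht : 0 < t) {j : ℤ} {r : R} :
    r ∈ fracGrading t 𝒜 j ↔ r = 0 ∨ ∃ i, j = t * i ∧ r ∈ 𝒜 i := by
  have ht' : (t : ℤ) ≠ 0 := by exact_mod_cast ht.ne'
  unfold fracGrading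
  split_ifs with h
  · obtain ⟨i, rfl⟩ := h
    rw [Int.mul_ediv_cancel_left _ ht']
    constructor
    · exact fun h => .inr ⟨i, rfl, h⟩
    · rintro (rfl | ⟨i', h, hr⟩)
      · exact zero_mem _
      · rwa [mul_left_cancel₀ ht' h]
  · rw [Submodule.mem_bot]
    exact ⟨.inl, fun h' => h'.resolve_right fun ⟨i, hi, _⟩ => h ⟨i, hi⟩⟩

theorem mem_fracGrading_mul {t : ℕ} (ht : 0 < t) {i : ℤ} {r : R} :
    r ∈ fracGrading t 𝒜 (t * i) ↔ r ∈ 𝒜 i := by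
  have ht' : (t : ℤ) ≠ 0 := by exact_mod_cast ht.ne'
  rw [fracGrading, if_pos (dvd_mul_right _ _), Int.mul_ediv_cancel_left _ ht']

theorem gradedMonoid_fracGrading [SetLike.GradedMonoid 𝒜] {t : ℕ} (ht : 0 < t) :
    SetLike.GradedMonoid (fracGrading t 𝒜) where
  one_mem := by
    rw [← mul_zero (t : ℤ), mem_fracGrading_mul ht]
    exact SetLike.GradedOne.one_mem
  mul_mem i j r s hr hs := by
    obtain rfl | ⟨i', rfl, hr'⟩ := (mem_fracGrading_iff ht).1 hr
    · rw [zero_mul]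
      exact zero_mem _
    obtain rfl | ⟨j', rfl, hs'⟩ := (mem_fracGrading_iff ht).1 hs
    · rw [mul_zero]
      exact zero_mem _
    rw [← mul_add, mem_fracGrading_mul ht]
    exact SetLike.GradedMul.mul_mem hr' hs'

theorem irrelevantIdeal_fracGrading {t : ℕ} (ht : 0 < t) :
    irrelevantIdeal (fracGrading t 𝒜) = irrelevantIdeal 𝒜 := by
  have ht' : (0 : ℤ) < t := by exact_mod_cast ht
  refine le_antisymm (Ideal.span_le.2 ?_) (Ideal.span_le.2 ?_)
  · rintro a ⟨j, hj, ha⟩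
    obtain rfl | ⟨i, rfl, ha'⟩ := (mem_fracGrading_iff ht).1 ha
    · exact zero_mem _
    · exact Ideal.subset_span ⟨i, pos_of_mul_pos_right hj ht'.le, ha'⟩
  · rintro a ⟨j, hj, ha⟩
    exact Ideal.subset_span ⟨t * j, mul_pos ht' hj, (mem_fracGrading_mul ht).2 ha⟩

/-- The regularity over `R^{(1/t)}` regrades first by `t` and then by `d`, whereas the comparison of
resolutions applies the factor `t` last. -/
theorem fracGrading_fracGrading (s t : ℕ) (ht : 0 < t) (hs : 0 < s) :
    fracGrading s (fracGrading t 𝒜) = fracGrading t (fracGrading s 𝒜) := by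
  funext j
  ext r
  simp only [mem_fracGrading_iff ht, mem_fracGrading_iff hs]
  constructor
  · rintro (h | ⟨_, rfl, h | ⟨i, rfl, h⟩⟩)
    · exact .inl h
    · exact .inl h
    · exact .inr ⟨s * i, by ring, .inr ⟨i, rfl, h⟩⟩
  · rintro (h | ⟨_, rfl, h | ⟨i, rfl, h⟩⟩)
    · exact .inl h
    · exact .inl h
    · exact .inr ⟨t * i, by ring, .inr ⟨i, rfl, h⟩⟩

theorem fracGrading_one : fracGrading 1 𝒜 = 𝒜 := by
  funext j
  simp [fracGrading]

end FracGrading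

/-- The homogeneous components of an element of an ideal generated by homogeneous elements. -/
theorem decompose_mem_closure_of_mem_span {l : Type v₁} {S : Type v} [Field l] [CommRing S]
    [Algebra l S] (𝒮 : ℤ → Submodule l S) [GradedAlgebra 𝒮] {P : ℤ → S → Prop}
    (hP : ∀ a x, P a x → x ∈ 𝒮 a) {y : S} (hy : y ∈ Ideal.span {x | ∃ a, P a x}) (e : ℤ) :
    (DirectSum.decompose 𝒮 y e : S) ∈ AddSubmonoid.closure
      {z | ∃ (a b : ℤ) (s x : S), P a x ∧ s ∈ 𝒮 b ∧ b + a = e ∧ z = s * x} := by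
  induction hy using Submodule.span_induction generalizing e with
  | mem x hx =>
    obtain ⟨a, hx⟩ := hx
    have ha := hP a x hx
    by_cases h : a = e
    · subst h
      rw [DirectSum.decompose_of_mem_same 𝒮 ha]
      exact AddSubmonoid.subset_closure
        ⟨a, 0, 1, x, hx, SetLike.GradedOne.one_mem, zero_add _, (one_mul x).symm⟩
    · rw [DirectSum.decompose_of_mem_ne 𝒮 ha h]
      exact zero_mem _
  | zero => simp
  | add x y _ _ hx hy =>
    rw [DirectSum.decompose_add, DirectSum.add_apply, Submodule.coe_add]
    exact add_mem (hx e) (hy e)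
  | smul s y _ hy =>
    induction s using DirectSum.Decomposition.inductionOn 𝒮 with
    | zero => simp
    | add s t hs ht =>
      rw [add_smul, DirectSum.decompose_add, DirectSum.add_apply, Submodule.coe_add]
      exact add_mem hs ht
    | @homogeneous i s =>
      -- For `s` of degree `i`, the degree `e` component of `s * y` is `s` times the component of
      -- `y` of degree `e - i`.
      rw [← add_sub_cancel i e, smul_eq_mul, DirectSum.coe_decompose_mul_add_of_left_mem 𝒮 s.2]
      have h := hy (e - i)
      generalize (DirectSum.decompose 𝒮 y (e - i) : S) = y' at h ⊢
      induction h using AddSubmonoid.closure_induction with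
      | mem z hz =>
        obtain ⟨a, b, s', x, hx, hs', h, rfl⟩ := hz
        exact AddSubmonoid.subset_closure ⟨a, i + b, s * s', x, hx,
          SetLike.GradedMul.mul_mem s.2 hs', by rw [add_assoc, h], (mul_assoc _ _ _).symm⟩
      | zero => rw [mul_zero]; exact zero_mem _
      | add x y _ _ hx hy => rw [mul_add]; exact add_mem hx hy

/-! ## The Koszul complex and the regularity for different generators -/

theorem map_id_eq_smul {R G A : Type*} [CommRing R] [AddCommGroup G] [AddCommGroup A] [Module R G]
    [Module R A] {r : R} {y : A →ₗ[R] A} (h : ∀ m, y m = r • m) (z : G ⊗[R] A) :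
    TensorProduct.map LinearMap.id y z = r • z := by
  rw [show y = r • LinearMap.id from LinearMap.ext h, TensorProduct.map_smul_right,
    TensorProduct.map_id, LinearMap.smul_apply, LinearMap.id_apply]

section Independence

variable {k : Type u₁} {l : Type v₁} {R : Type u} {S : Type v} [Field k] [Field l]
  [CommRing R] [CommRing S] [Algebra k R] [Algebra l S]
  {𝒜 : ℤ → Submodule k R} {𝒮 : ℤ → Submodule l S}

theorem koszul_smul_mem {M : GrComplex.{v, w} S}
    (hM : ∀ (a i b : ℤ) (s : S) (m : M.carrier), s ∈ 𝒮 a → m ∈ M.gr i b → s • m ∈ M.gr i (a + b))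
    (e : ℤ) (xs : List S) (a i b : ℤ) (s : S) (m : (M.koszul e xs).carrier) (hs : s ∈ 𝒮 a)
    (hm : m ∈ (M.koszul e xs).gr i b) : s • m ∈ (M.koszul e xs).gr i (a + b) := by
  induction xs generalizing i b with
  | nil => exact hM a i b s m hs hm
  | cons x xs ih =>
    refine ⟨ih i b m.1 hm.1, ?_⟩
    have := ih (i - 1) (b - e) m.2 hm.2
    rwa [← add_sub_assoc] at this

/-- The action of `s : S` on the derived tensor product of the residue field with a complex. -/
def tensorAct (𝒜 : ℤ → Submodule k R) (φ : R →+* S) (K : GrComplex.{v, w} S) (s : S) :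
    (ResBasis 𝒜 →₀ R) ⊗[R] (K.restrict φ).carrier →ₗ[R]
      (ResBasis 𝒜 →₀ R) ⊗[R] (K.restrict φ).carrier :=
  TensorProduct.map LinearMap.id (K.restrictSMul φ s)

theorem tensorAct_add (φ : R →+* S) (K : GrComplex.{v, w} S) (s t : S)
    (z : (ResBasis 𝒜 →₀ R) ⊗[R] (K.restrict φ).carrier) :
    tensorAct 𝒜 φ K (s + t) z = tensorAct 𝒜 φ K s z + tensorAct 𝒜 φ K t z := by
  have : K.restrictSMul φ (s + t) = K.restrictSMul φ s + K.restrictSMul φ t :=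
    LinearMap.ext fun m => add_smul (M := K.carrier) s t m
  rw [tensorAct, this, TensorProduct.map_add_right, LinearMap.add_apply, tensorAct, tensorAct]

theorem tensorAct_zero (φ : R →+* S) (K : GrComplex.{v, w} S)
    (z : (ResBasis 𝒜 →₀ R) ⊗[R] (K.restrict φ).carrier) : tensorAct 𝒜 φ K 0 z = 0 := by
  have : K.restrictSMul φ 0 = 0 := LinearMap.ext fun m => zero_smul S (show K.carrier from m)
  rw [tensorAct, this, TensorProduct.map_zero_right, LinearMap.zero_apply]

theorem tensorAct_mul (φ : R →+* S) (K : GrComplex.{v, w} S) (s t : S)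
    (z : (ResBasis 𝒜 →₀ R) ⊗[R] (K.restrict φ).carrier) :
    tensorAct 𝒜 φ K (s * t) z = tensorAct 𝒜 φ K s (tensorAct 𝒜 φ K t z) := by
  have : K.restrictSMul φ (s * t) = K.restrictSMul φ s ∘ₗ K.restrictSMul φ t :=
    LinearMap.ext fun m => mul_smul (β := K.carrier) s t m
  rw [tensorAct, this, tensorAct, tensorAct, ← LinearMap.comp_apply, ← TensorProduct.map_comp,
    LinearMap.id_comp]

theorem tensorAct_map (φ : R →+* S) (K : GrComplex.{v, w} S) (r : R)
    (z : (ResBasis 𝒜 →₀ R) ⊗[R] (K.restrict φ).carrier) :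
    tensorAct 𝒜 φ K (φ r) z = r • z := by
  have h : ∀ m : (K.restrict φ).carrier, K.restrictSMul φ (φ r) m = r • m := fun _ => rfl
  exact map_id_eq_smul h z

theorem tensorD_tensorAct (φ : R →+* S) (K : GrComplex.{v, w} S) (s : S)
    (z : (ResBasis 𝒜 →₀ R) ⊗[R] (K.restrict φ).carrier) :
    tensorAct 𝒜 φ K s (tensorD 𝒜 (K.restrict φ) z) =
      tensorD 𝒜 (K.restrict φ) (tensorAct 𝒜 φ K s z) := by
  have h : ∀ m : (K.restrict φ).carrier, K.restrictSMul φ s ((K.restrict φ).d m) =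
      (K.restrict φ).d (K.restrictSMul φ s m) := fun m => (K.d.map_smul s m).symm
  exact tensorTotal_map_id h z

theorem tensorAct_mem {φ : R →+* S} {K : GrComplex.{v, w} S}
    (hK : ∀ (a i b : ℤ) (s : S) (m : K.carrier), s ∈ 𝒮 a → m ∈ K.gr i b → s • m ∈ K.gr i (a + b))
    {a n j : ℤ} {s : S} (hs : s ∈ 𝒮 a) {z : (ResBasis 𝒜 →₀ R) ⊗[R] (K.restrict φ).carrier}
    (hz : z ∈ tensorGr 𝒜 (K.restrict φ) n j) :
    tensorAct 𝒜 φ K s z ∈ tensorGr 𝒜 (K.restrict φ) n (j + a) :=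
  map_mem_tensorGr (g := K.restrictSMul φ s) (q₀ := 0) (b₀ := a) id_mem_resGr
    (fun q b m hm => by rw [add_zero, add_comm]; exact hK a q b s m hs hm) (by ring) (by ring) hz

/-- A positive homogeneous element of `R` annihilates the derived tensor product with the residue
field, up to homotopy. -/
theorem killsHomology_map [SetLike.GradedMonoid 𝒜] (φ : R →+* S) (K : GrComplex.{v, w} S) {a : ℤ}
    (ha : 0 < a) {r : R} (hr : r ∈ 𝒜 a) :
    (derivedTensorResidue 𝒜 (K.restrict φ)).KillsHomology a (tensorAct 𝒜 φ K (φ r)) := by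
  intro i j z hz h0
  refine ⟨TensorProduct.map (resHomotopyTotal 𝒜 a r) LinearMap.id z, ?_, ?_⟩
  · exact map_mem_tensorGr (q₀ := 0) (b₀ := 0) (resHomotopyTotal_mem_resGr a r)
      (fun q b m hm => by rw [add_zero, add_zero]; exact hm) (by ring) (by ring) hz
  · have := tensorTotal_homotopy_left (σ := resSign 𝒜) (K.restrict φ).d
      (resD_resHomotopyTotal hr (Ideal.subset_span ⟨a, ha, hr⟩)) (resSign_resHomotopyTotal a r) z
    change tensorD 𝒜 (K.restrict φ) z = 0 at h0
    change tensorD 𝒜 (K.restrict φ) _ + TensorProduct.map _ _ (tensorD 𝒜 (K.restrict φ) z) = _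
      at this
    rw [h0, map_zero, add_zero] at this
    exact this.trans (tensorAct_map φ K r z).symm

/-- The null-homotopy of `x` on the Koszul complex is `R`-linear after restriction and survives
tensoring with the resolution. -/
theorem killsHomology_of_mem [SetLike.GradedMonoid 𝒜] (φ : R →+* S) (M : GrComplex.{v, w} S)
    {e : ℤ} {xs : List S} {x : S} (hx : x ∈ xs) :
    (derivedTensorResidue 𝒜 ((M.koszul e xs).restrict φ)).KillsHomology e
      (tensorAct 𝒜 φ (M.koszul e xs) x) := by
  intro i j z hz h0
  obtain ⟨η, h₁, h₂⟩ := M.exists_koszul_homotopy e hx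
  let K := M.koszul e xs
  let η' : (K.restrict φ).carrier →ₗ[R] (K.restrict φ).carrier :=
    { toFun := η
      map_add' := η.map_add
      map_smul' := fun r m => η.map_smul (φ r) m }
  refine ⟨TensorProduct.map (resSign 𝒜) η' z, ?_, ?_⟩
  · exact map_mem_tensorGr (q₀ := 1) (b₀ := e) (p₀ := 0) (a₀ := 0) resSign_mem_resGr
      (N' := (M.koszul e xs).restrict φ) h₂ (by ring) (by ring) hz
  · have := tensorTotal_homotopy_right (δ := resD 𝒜) (σ := resSign 𝒜) (d := (K.restrict φ).d)
      (η := η') (y := K.restrictSMul φ x) h₁ resSign_resD resSign_resSign z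
    change tensorD 𝒜 (K.restrict φ) z = 0 at h0
    change tensorD 𝒜 (K.restrict φ) _ + TensorProduct.map _ _ (tensorD 𝒜 (K.restrict φ) z) = _
      at this
    rw [h0, map_zero, add_zero] at this
    exact this

/-- Nonvanishing of the `(i, j)` Betti number. -/
def bettiNonzero (𝒜 : ℤ → Submodule k R) (φ : R →+* S) (d : ℕ) (e : ℤ) (xs : List S)
    (M : GrComplex.{v, w} S) (i j : ℤ) : Prop :=
  (derivedTensorResidue (fracGrading d 𝒜) ((M.koszul e xs).restrict φ)).HasHomology i j

/-- The integers `j - ie` for which the `(i, j)` Betti number does not vanish. -/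
def bettiShifts (𝒜 : ℤ → Submodule k R) (φ : R →+* S) (d : ℕ) (e : ℤ) (xs : List S)
    (M : GrComplex.{v, w} S) : Set ℤ :=
  {q | ∃ i j, bettiNonzero 𝒜 φ d e xs M i j ∧ j - i * e = q}

theorem bettiShifts_perm (φ : R →+* S) (d : ℕ) (M : GrComplex.{v, w} S) (e : ℤ) {xs ys : List S}
    (h : xs.Perm ys) : bettiShifts 𝒜 φ d e xs M = bettiShifts 𝒜 φ d e ys M := by
  obtain ⟨f⟩ := M.nonempty_grEquiv_koszul_of_perm e h
  ext q
  simp only [bettiShifts, bettiNonzero,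
    ((f.restrict φ).derivedTensor (fracGrading d 𝒜)).hasHomology_iff]

/-- The quotient `(j - idg) / (dg)` depends on the pair `(i, j)` only through its shift. -/
theorem regOver_eq_sSup (φ : R →+* S) (d g : ℕ) (xs : List S) (M : GrComplex.{v, w} S) :
    regOver 𝒜 φ d g xs M =
      sSup ((fun q : ℤ => (((q : ℝ) / (d * g) : ℝ) : EReal)) '' bettiShifts 𝒜 φ d (d * g) xs M) := by
  unfold regOver
  congr 1
  ext r
  constructor
  · rintro ⟨i, j, h, rfl⟩
    exact ⟨_, ⟨i, j, (GrComplex.nontrivial_homologyGr_iff _ i j).1 h, rfl⟩, by push_cast; rfl⟩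
  · rintro ⟨_, ⟨i, j, h, rfl⟩, rfl⟩
    exact ⟨i, j, (GrComplex.nontrivial_homologyGr_iff _ i j).2 h, by push_cast; rfl⟩

variable [GradedAlgebra 𝒜] [GradedAlgebra 𝒮]

/-- Homogeneous elements that kill homology are closed under multiplication by homogeneous elements
of `S` and under sums in a fixed degree. It therefore suffices that the generators of the ideal kill
homology. -/
theorem killsHomology_of_mem_span {φ : R →+* S} {d : ℕ} (hφ : HasOrder 𝒜 𝒮 φ d)
    {M : GrComplex.{v, w} S}
    (hM : ∀ (a i b : ℤ) (s : S) (m : M.carrier), s ∈ 𝒮 a → m ∈ M.gr i b → s • m ∈ M.gr i (a + b))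
    {e : ℤ} {xs : List S} (hxs : ∀ x ∈ xs, x ∈ 𝒮 e) {y : S} (hy : y ∈ 𝒮 e)
    (hspan : y ∈ Ideal.span {x | x ∈ xs} ⊔ (irrelevantIdeal 𝒜).map φ) :
    (derivedTensorResidue (fracGrading d 𝒜) ((M.koszul e xs).restrict φ)).KillsHomology e
      (tensorAct (fracGrading d 𝒜) φ (M.koszul e xs) y) := by
  have : SetLike.GradedMonoid (fracGrading d 𝒜) := gradedMonoid_fracGrading hφ.1
  -- The ideal `𝔪` is read in `R^{(1/d)}`, where `φ` preserves degrees.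
  rw [← irrelevantIdeal_fracGrading hφ.1, irrelevantIdeal, Ideal.map_span,
    ← Ideal.span_union] at hspan
  let P : ℤ → S → Prop := fun a x => x ∈ 𝒮 a ∧
    (derivedTensorResidue (fracGrading d 𝒜) ((M.koszul e xs).restrict φ)).KillsHomology a
      (tensorAct (fracGrading d 𝒜) φ (M.koszul e xs) x)
  have hspan' : y ∈ Ideal.span {x | ∃ a, P a x} := by
    refine Ideal.span_mono ?_ hspan
    rintro x (hx | ⟨r, ⟨j, hj, hr⟩, rfl⟩)
    · exact ⟨e, hxs x hx, killsHomology_of_mem φ M hx⟩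
    · refine ⟨j, ?_, killsHomology_map φ _ hj hr⟩
      obtain rfl | ⟨i, rfl, hr'⟩ := (mem_fracGrading_iff hφ.1).1 hr
      · rw [map_zero]
        exact zero_mem _
      · exact hφ.2 i r hr'
  -- Since `y` is its own component of degree `e`, it is a sum of products `s * x` of total degree
  -- `e` with `x` a killing element.
  have h := decompose_mem_closure_of_mem_span 𝒮 (fun a x (hx : P a x) => hx.1) hspan' e
  rw [DirectSum.decompose_of_mem_same 𝒮 hy] at h
  clear hy hspan hspan'
  intro i j z hz h0
  induction h using AddSubmonoid.closure_induction with
  | mem y hy =>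
    obtain ⟨a, b, s, x, ⟨_, hx⟩, hs, hab, rfl⟩ := hy
    obtain ⟨w, hw, h⟩ := hx i j z hz h0
    refine ⟨tensorAct (fracGrading d 𝒜) φ (M.koszul e xs) s w, ?_, ?_⟩
    · have := tensorAct_mem (koszul_smul_mem hM e xs) hs hw
      rwa [add_assoc, add_comm a b, hab] at this
    · exact ((tensorD_tensorAct φ _ s w).symm.trans (congrArg _ h)).trans
        (tensorAct_mul φ _ s x z).symm
  | zero => exact ⟨0, zero_mem _, (map_zero _).trans (tensorAct_zero φ _ z).symm⟩
  | add y y' _ _ h h' =>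
    obtain ⟨w, hw, h⟩ := h
    obtain ⟨w', hw', h'⟩ := h'
    exact ⟨w + w', add_mem hw hw', ((map_add _ w w').trans (congrArg₂ _ h h')).trans
      (tensorAct_add φ _ y y' z).symm⟩

/-- Adding a redundant element to the sequence. -/
theorem bettiNonzero_cons_iff {φ : R →+* S} {d : ℕ} (hφ : HasOrder 𝒜 𝒮 φ d)
    {M : GrComplex.{v, w} S}
    (hM : ∀ (a i b : ℤ) (s : S) (m : M.carrier), s ∈ 𝒮 a → m ∈ M.gr i b → s • m ∈ M.gr i (a + b))
    {e : ℤ} {xs : List S} (hxs : ∀ x ∈ xs, x ∈ 𝒮 e) {y : S} (hy : y ∈ 𝒮 e)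
    (hspan : y ∈ Ideal.span {x | x ∈ xs} ⊔ (irrelevantIdeal 𝒜).map φ) (i j : ℤ) :
    bettiNonzero 𝒜 φ d e (y :: xs) M i j ↔
      bettiNonzero 𝒜 φ d e xs M i j ∨ bettiNonzero 𝒜 φ d e xs M (i - 1) (j - e) := by
  have : SetLike.GradedMonoid (fracGrading d 𝒜) := gradedMonoid_fracGrading hφ.1
  refine ((derivedTensorCone (fracGrading d 𝒜) ((M.koszul e xs).restrict φ) e
    ((M.koszul e xs).restrictSMul φ y)).hasHomology_iff i j).trans ?_
  exact GrComplex.hasHomology_cone_iff _ e _ (tensorD_tensorAct φ _ y)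
    (fun i j m hm => tensorAct_mem (koszul_smul_mem hM e xs) hy hm)
    (killsHomology_of_mem_span hφ hM hxs hy hspan) i j

/-- The new Betti numbers are the old ones and their shifts by `(1, e)`, and `(j - e) - (i - 1) * e
= j - i * e`. -/
theorem bettiShifts_cons {φ : R →+* S} {d : ℕ} (hφ : HasOrder 𝒜 𝒮 φ d)
    {M : GrComplex.{v, w} S}
    (hM : ∀ (a i b : ℤ) (s : S) (m : M.carrier), s ∈ 𝒮 a → m ∈ M.gr i b → s • m ∈ M.gr i (a + b))
    {e : ℤ} {xs : List S} (hxs : ∀ x ∈ xs, x ∈ 𝒮 e) {y : S} (hy : y ∈ 𝒮 e)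
    (hspan : y ∈ Ideal.span {x | x ∈ xs} ⊔ (irrelevantIdeal 𝒜).map φ) :
    bettiShifts 𝒜 φ d e (y :: xs) M = bettiShifts 𝒜 φ d e xs M := by
  ext q
  constructor
  · rintro ⟨i, j, h, rfl⟩
    obtain h | h := (bettiNonzero_cons_iff hφ hM hxs hy hspan i j).1 h
    · exact ⟨i, j, h, rfl⟩
    · exact ⟨i - 1, j - e, h, by ring⟩
  · rintro ⟨i, j, h, rfl⟩
    exact ⟨i, j, (bettiNonzero_cons_iff hφ hM hxs hy hspan i j).2 (.inl h), rfl⟩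

theorem bettiShifts_append {φ : R →+* S} {d : ℕ} (hφ : HasOrder 𝒜 𝒮 φ d)
    {M : GrComplex.{v, w} S}
    (hM : ∀ (a i b : ℤ) (s : S) (m : M.carrier), s ∈ 𝒮 a → m ∈ M.gr i b → s • m ∈ M.gr i (a + b))
    {e : ℤ} {xs ys : List S} (hxs : ∀ x ∈ xs, x ∈ 𝒮 e) (hys : ∀ y ∈ ys, y ∈ 𝒮 e)
    (hspan : ∀ y ∈ ys, y ∈ Ideal.span {x | x ∈ xs} ⊔ (irrelevantIdeal 𝒜).map φ) :
    bettiShifts 𝒜 φ d e (ys ++ xs) M = bettiShifts 𝒜 φ d e xs M := by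
  induction ys with
  | nil => rfl
  | cons y ys ih =>
    rw [List.cons_append, bettiShifts_cons hφ hM _ (hys y List.mem_cons_self)]
    · exact ih (fun y hy => hys y (List.mem_cons_of_mem _ hy))
        (fun y hy => hspan y (List.mem_cons_of_mem _ hy))
    · have h : Ideal.span {x | x ∈ xs} ≤ Ideal.span {x | x ∈ ys ++ xs} :=
        Ideal.span_mono fun x hx => List.mem_append_right ys hx
      exact sup_le_sup_right h ((irrelevantIdeal 𝒜).map φ) (hspan y List.mem_cons_self)
    · intro x hx
      obtain hx | hx := List.mem_append.1 hx
      · exact hys x (List.mem_cons_of_mem _ hx)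
      · exact hxs x hx

/-- Two sequences of the same degree that generate the same ideal modulo `𝔪S` yield the same
shifts. -/
theorem bettiShifts_eq {φ : R →+* S} {d : ℕ} (hφ : HasOrder 𝒜 𝒮 φ d)
    {M : GrComplex.{v, w} S}
    (hM : ∀ (a i b : ℤ) (s : S) (m : M.carrier), s ∈ 𝒮 a → m ∈ M.gr i b → s • m ∈ M.gr i (a + b))
    {e : ℤ} {xs ys : List S} (hxs : ∀ x ∈ xs, x ∈ 𝒮 e) (hys : ∀ y ∈ ys, y ∈ 𝒮 e)
    (hspan : ∀ y ∈ ys, y ∈ Ideal.span {x | x ∈ xs} ⊔ (irrelevantIdeal 𝒜).map φ)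
    (hspan' : ∀ x ∈ xs, x ∈ Ideal.span {y | y ∈ ys} ⊔ (irrelevantIdeal 𝒜).map φ) :
    bettiShifts 𝒜 φ d e xs M = bettiShifts 𝒜 φ d e ys M := by
  -- Each sequence is redundant modulo the other, so both agree with the concatenation.
  rw [← bettiShifts_append hφ hM hxs hys hspan, bettiShifts_perm φ d M e List.perm_append_comm,
    bettiShifts_append hφ hM hys hxs hspan']

end Independence

/-! ## Comparison of resolutions for fractional gradings -/

theorem mem_iSup_iff_exists_sum {A ι : Type*} [AddCommGroup A] [Fintype ι]
    (B : ι → AddSubgroup A) {z : A} :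
    z ∈ ⨆ r, B r ↔ ∃ f : ι → A, (∀ r, f r ∈ B r) ∧ ∑ r, f r = z := by
  classical
  constructor
  · intro h
    refine AddSubgroup.iSup_induction B
      (C := fun z => ∃ f : ι → A, (∀ r, f r ∈ B r) ∧ ∑ r, f r = z) h ?_ ?_ ?_
    · intro i x hx
      refine ⟨Pi.single i x, fun r => ?_, by simp⟩
      by_cases h : r = i
      · subst h
        rwa [Pi.single_eq_same]
      · rw [Pi.single_eq_of_ne h]
        exact zero_mem _
    · exact ⟨0, fun r => zero_mem _, by simp⟩
    · rintro x y ⟨f, hf, rfl⟩ ⟨g, hg, rfl⟩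
      exact ⟨f + g, fun r => add_mem (hf r) (hg r), Finset.sum_add_distrib⟩
  · rintro ⟨f, hf, rfl⟩
    exact sum_mem fun r _ => AddSubgroup.mem_iSup_of_mem r (hf r)

section FracResolution

variable {k : Type u₁} {R : Type u} [Field k] [CommRing R] [Algebra k R]

/-- A bijection of the bases of two steps that multiplies degrees by `t` and matches the
submodules of cycles. -/
structure ResStepEquiv (t : ℕ) (X Y : ResStep.{u} R) where
  equiv : X.B ≃ Y.B
  deg : ∀ b, Y.deg (equiv b) = t * X.deg b
  mem : ∀ z, Finsupp.domLCongr (M := R) (R := R) equiv z ∈ Y.Z ↔ z ∈ X.Z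

variable {𝒜 : ℤ → Submodule k R} {t : ℕ}

theorem ResStepEquiv.apply_mem_iff (ht : 0 < t) {p : ℕ}
    (f : ResStepEquiv t (resStep 𝒜 p) (resStep (fracGrading t 𝒜) p))
    (z : (resStep 𝒜 p).B →₀ R) (a : ℤ) :
    (∀ c, Finsupp.domLCongr (M := R) (R := R) f.equiv z c ∈
      fracGrading t 𝒜 (t * a - (resStep (fracGrading t 𝒜) p).deg c)) ↔
    ∀ c, z c ∈ 𝒜 (a - (resStep 𝒜 p).deg c) := by
  rw [← f.equiv.forall_congr_right]
  refine forall_congr' fun c => ?_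
  rw [f.deg, ← mul_sub, mem_fracGrading_mul ht, Finsupp.domLCongr_apply, Finsupp.domCongr_apply,
    Finsupp.equivMapDomain_apply, Equiv.symm_apply_apply]

/-- The map on basis elements of step `p + 1` induced by an equivalence of steps `p`. -/
def ResStepEquiv.succFun (ht : 0 < t) {p : ℕ}
    (f : ResStepEquiv t (resStep 𝒜 p) (resStep (fracGrading t 𝒜) p))
    (b : (resStep 𝒜 (p + 1)).B) : (resStep (fracGrading t 𝒜) (p + 1)).B :=
  resMk (t * (resStep 𝒜 (p + 1)).deg b) (Finsupp.domLCongr (M := R) (R := R) f.equiv (resElt b))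
    ⟨(f.mem _).2 b.2.1, fun h => b.2.2.1 ((LinearEquiv.map_eq_zero_iff _).1 h),
      (f.apply_mem_iff ht _ _).2 b.2.2.2⟩

theorem ResStepEquiv.succFun_bijective (ht : 0 < t) {p : ℕ}
    (f : ResStepEquiv t (resStep 𝒜 p) (resStep (fracGrading t 𝒜) p)) :
    Function.Bijective (f.succFun ht) := by
  have ht' : (t : ℤ) ≠ 0 := by exact_mod_cast ht.ne'
  constructor
  · rintro ⟨⟨a, z⟩, hz⟩ ⟨⟨a', z'⟩, hz'⟩ h
    have h₁ : (t : ℤ) * a = t * a' := congrArg (fun b => b.1.1) h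
    have h₂ : Finsupp.domLCongr (M := R) (R := R) f.equiv z =
      Finsupp.domLCongr (M := R) (R := R) f.equiv z' := congrArg (fun b => b.1.2) h
    exact Subtype.ext (Prod.ext (mul_left_cancel₀ ht' h₁) (LinearEquiv.injective _ h₂))
  · rintro ⟨⟨a, z⟩, hz, h0, ha⟩
    -- A nonzero coefficient forces the recorded degree to be a multiple of `t`. This is why only
    -- nonzero cycles may serve as basis elements: zero would occur in every degree and spoil
    -- surjectivity.
    obtain ⟨c, hc⟩ : ∃ c, z c ≠ 0 := by
      by_contra h
      push Not at h
      exact h0 (Finsupp.ext h)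
    obtain ⟨c, rfl⟩ := f.equiv.surjective c
    obtain h | ⟨i, hi, _⟩ := (mem_fracGrading_iff ht).1 (ha (f.equiv c))
    · exact (hc h).elim
    obtain ⟨z, rfl⟩ := (Finsupp.domLCongr (M := R) (R := R) f.equiv).surjective z
    have hi' : a = t * (i + (resStep 𝒜 p).deg c) := by
      change a - _ = _ at hi
      rw [f.deg] at hi
      linear_combination hi
    subst hi'
    exact ⟨resMk (i + (resStep 𝒜 p).deg c) z ⟨(f.mem z).1 hz, fun h => h0 (by
      change Finsupp.domLCongr (M := R) (R := R) f.equiv z = 0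
      rw [h, map_zero]), (f.apply_mem_iff ht z _).1 ha⟩, rfl⟩

theorem ResStepEquiv.resStepD_succ (ht : 0 < t) {p : ℕ}
    (f : ResStepEquiv t (resStep 𝒜 p) (resStep (fracGrading t 𝒜) p))
    (z : (resStep 𝒜 (p + 1)).B →₀ R) :
    resStepD (fracGrading t 𝒜) p (Finsupp.domLCongr (M := R) (R := R)
      (Equiv.ofBijective _ (f.succFun_bijective ht)) z) =
    Finsupp.domLCongr (M := R) (R := R) f.equiv (resStepD 𝒜 p z) := by
  induction z using Finsupp.induction_linear with
  | zero => simp only [map_zero]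
  | add x y hx hy => simp only [map_add, hx, hy]
  | single b r =>
    rw [Finsupp.domLCongr_single, resStepD_single, resStepD_single, map_smul]
    rfl

/-- The bases of the resolutions for `𝒜` and for `fracGrading t 𝒜` correspond to each other. -/
def resStepFrac (ht : 0 < t) :
    (p : ℕ) → ResStepEquiv t (resStep 𝒜 p) (resStep (fracGrading t 𝒜) p)
  | 0 =>
    { equiv := Equiv.refl PUnit
      deg := fun _ => (mul_zero (t : ℤ)).symm
      mem := fun z => by
        change z PUnit.unit ∈ irrelevantIdeal (fracGrading t 𝒜) ↔
          z PUnit.unit ∈ irrelevantIdeal 𝒜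
        rw [irrelevantIdeal_fracGrading ht] }
  | p + 1 =>
    { equiv := Equiv.ofBijective _ ((resStepFrac ht p).succFun_bijective ht)
      deg := fun _ => rfl
      mem := fun z => by
        rw [mem_resStep_succ_iff, mem_resStep_succ_iff, ResStepEquiv.resStepD_succ,
          LinearEquiv.map_eq_zero_iff] }

/-- The isomorphism of the resolutions for `𝒜` and for `fracGrading t 𝒜`. -/
def resFrac (𝒜 : ℤ → Submodule k R) (ht : 0 < t) :
    (ResBasis 𝒜 →₀ R) ≃ₗ[R] (ResBasis (fracGrading t 𝒜) →₀ R) :=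
  Finsupp.domLCongr (Equiv.sigmaCongrRight fun p => (resStepFrac ht p).equiv)

theorem resFrac_single (ht : 0 < t) (b : ResBasis 𝒜) (r : R) :
    resFrac 𝒜 ht (Finsupp.single b r) =
      Finsupp.single ⟨b.1, (resStepFrac ht b.1).equiv b.2⟩ r :=
  Finsupp.domLCongr_single _ _ _

theorem resFrac_mapDomain (ht : 0 < t) (p : ℕ) (z : (resStep 𝒜 p).B →₀ R) :
    resFrac 𝒜 ht (Finsupp.mapDomain (Sigma.mk p) z) =
      Finsupp.mapDomain (Sigma.mk p)
        (Finsupp.domLCongr (M := R) (R := R) (resStepFrac ht p).equiv z) := by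
  induction z using Finsupp.induction_linear with
  | zero => simp only [map_zero, Finsupp.mapDomain_zero]
  | add x y hx hy => simp only [map_add, Finsupp.mapDomain_add, hx, hy]
  | single b r =>
    rw [Finsupp.mapDomain_single, resFrac_single, Finsupp.domLCongr_single,
      Finsupp.mapDomain_single]

theorem resFrac_resD (ht : 0 < t) (x : ResBasis 𝒜 →₀ R) :
    resFrac 𝒜 ht (resD 𝒜 x) = resD (fracGrading t 𝒜) (resFrac 𝒜 ht x) := by
  induction x using Finsupp.induction_linear with
  | zero => simp only [map_zero]
  | add x y hx hy => simp only [map_add, hx, hy]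
  | single b r =>
    rw [resFrac_single, resD_single, resD_single, map_smul]
    obtain ⟨_ | p, b⟩ := b
    · exact congrArg _ (map_zero (resFrac 𝒜 ht))
    · exact congrArg _ (resFrac_mapDomain ht p (resElt b))

theorem resFrac_resSign (ht : 0 < t) (x : ResBasis 𝒜 →₀ R) :
    resFrac 𝒜 ht (resSign 𝒜 x) = resSign (fracGrading t 𝒜) (resFrac 𝒜 ht x) := by
  induction x using Finsupp.induction_linear with
  | zero => simp only [map_zero]
  | add x y hx hy => simp only [map_add, hx, hy]
  | single b r => rw [resFrac_single, resSign_single, resSign_single, map_zsmul, resFrac_single]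

theorem resFrac_mem_resGr_iff (ht : 0 < t) {p a : ℤ} {x : ResBasis 𝒜 →₀ R} :
    resFrac 𝒜 ht x ∈ resGr (fracGrading t 𝒜) p (t * a) ↔ x ∈ resGr 𝒜 p a := by
  change (∀ b, _) ↔ ∀ b, _
  rw [← (Equiv.sigmaCongrRight fun p => (resStepFrac (𝒜 := 𝒜) ht p).equiv).forall_congr_right]
  refine forall_congr' fun b => ?_
  have h : resFrac 𝒜 ht x ((Equiv.sigmaCongrRight fun p => (resStepFrac ht p).equiv) b) = x b := by
    rw [resFrac, Finsupp.domLCongr_apply, Finsupp.domCongr_apply, Finsupp.equivMapDomain_apply,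
      Equiv.symm_apply_apply]
  rw [h]
  change x b ∈ fracGrading t 𝒜 (t * a -
    (resStep (fracGrading t 𝒜) b.1).deg ((resStepFrac ht b.1).equiv b.2)) ∧ _ ↔ _
  rw [(resStepFrac ht b.1).deg, ← mul_sub, mem_fracGrading_mul ht]
  rfl

theorem eq_zero_or_exists_of_mem_resGr_fracGrading (ht : 0 < t) {p a : ℤ}
    {x : ResBasis (fracGrading t 𝒜) →₀ R} (hx : x ∈ resGr (fracGrading t 𝒜) p a) :
    x = 0 ∨ ∃ a', a = t * a' ∧ (resFrac 𝒜 ht).symm x ∈ resGr 𝒜 p a' := by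
  by_cases h0 : x = 0
  · exact .inl h0
  obtain ⟨b, hb⟩ : ∃ b, x b ≠ 0 := by
    by_contra h
    push Not at h
    exact h0 (Finsupp.ext h)
  obtain ⟨p', b⟩ := b
  obtain ⟨b, rfl⟩ := (resStepFrac (𝒜 := 𝒜) ht p').equiv.surjective b
  obtain h | ⟨i, hi, _⟩ := (mem_fracGrading_iff ht).1 (hx _).1
  · exact (hb h).elim
  change a - (resStep (fracGrading t 𝒜) p').deg ((resStepFrac ht p').equiv b) = _ at hi
  rw [(resStepFrac ht p').deg] at hi
  have ha : a = t * (i + (resStep 𝒜 p').deg b) := by linear_combination hi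
  refine .inr ⟨_, ha, ?_⟩
  rw [← resFrac_mem_resGr_iff ht, ← ha, LinearEquiv.apply_symm_apply]
  exact hx

/-- The isomorphism of derived tensor products induced by the isomorphism of resolutions. -/
def tensorFrac (𝒜 : ℤ → Submodule k R) (ht : 0 < t) (A : Type w) [AddCommGroup A] [Module R A] :
    (ResBasis 𝒜 →₀ R) ⊗[R] A ≃ₗ[R] (ResBasis (fracGrading t 𝒜) →₀ R) ⊗[R] A :=
  TensorProduct.congr (resFrac 𝒜 ht) (.refl R A)

theorem tensorFrac_tensorTotal (ht : 0 < t) {A : Type w} [AddCommGroup A] [Module R A]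
    (d : A →ₗ[R] A) (z : (ResBasis 𝒜 →₀ R) ⊗[R] A) :
    tensorFrac 𝒜 ht A (tensorTotal (resD 𝒜) (resSign 𝒜) d z) =
      tensorTotal (resD (fracGrading t 𝒜)) (resSign (fracGrading t 𝒜)) d
        (tensorFrac 𝒜 ht A z) := by
  induction z using TensorProduct.induction_on with
  | zero => simp only [map_zero]
  | add x y hx hy => simp only [map_add, hx, hy]
  | tmul x m => simp [tensorFrac, tensorTotal_tmul, resFrac_resD, resFrac_resSign]

section TensorFracMem

variable {A : Type w} [AddCommGroup A] [Module R A] {gr gr' : ℤ → ℤ → AddSubgroup A}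

theorem tensorFrac_mem (ht : 0 < t) (h : ∀ q b, gr q b ≤ gr' q (t * b)) {i j : ℤ}
    {z : (ResBasis 𝒜 →₀ R) ⊗[R] A} (hz : z ∈ tensorGrOf 𝒜 gr i j) :
    tensorFrac 𝒜 ht A z ∈ tensorGrOf (fracGrading t 𝒜) gr' i (t * j) := by
  induction hz using AddSubgroup.closure_induction with
  | mem z hz =>
    obtain ⟨p, q, a, b, x, m, rfl, rfl, hx, hm, rfl⟩ := hz
    exact tmul_mem_tensorGrOf ((resFrac_mem_resGr_iff ht).2 hx) (h q b hm) rfl (mul_add _ _ _).symm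
  | zero => rw [map_zero]; exact zero_mem _
  | add y z _ _ hy hz => rw [map_add]; exact add_mem hy hz
  | neg z _ hz => rw [map_neg]; exact neg_mem hz

/-- The family `T` stands for the fractional grading of the tensor product. In the degrees that `t`
does not divide, every generator has a zero factor, so nothing is asked of `T` there. -/
theorem tensorFrac_symm_mem (ht : 0 < t)
    (h : ∀ q b, ∀ m ∈ gr' q b, m = 0 ∨ ∃ b', b = t * b' ∧ m ∈ gr q b')
    {T : ℤ → ℤ → AddSubgroup ((ResBasis 𝒜 →₀ R) ⊗[R] A)}
    (hT : ∀ i j, tensorGrOf 𝒜 gr i j ≤ T i (t * j)) {i j : ℤ}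
    {z : (ResBasis (fracGrading t 𝒜) →₀ R) ⊗[R] A}
    (hz : z ∈ tensorGrOf (fracGrading t 𝒜) gr' i j) : (tensorFrac 𝒜 ht A).symm z ∈ T i j := by
  induction hz using AddSubgroup.closure_induction with
  | mem z hz =>
    obtain ⟨p, q, a, b, x, m, rfl, rfl, hx, hm, rfl⟩ := hz
    obtain rfl | ⟨a, rfl, hx'⟩ := eq_zero_or_exists_of_mem_resGr_fracGrading ht hx
    · rw [TensorProduct.zero_tmul, map_zero]
      exact zero_mem _
    obtain rfl | ⟨b, rfl, hm'⟩ := h _ _ _ hm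
    · rw [TensorProduct.tmul_zero, map_zero]
      exact zero_mem _
    · rw [← mul_add]
      exact hT _ _ (tmul_mem_tensorGrOf hx' hm' rfl rfl)
  | zero => rw [map_zero]; exact zero_mem _
  | add y z _ _ hy hz => rw [map_add]; exact add_mem hy hz
  | neg z _ hz => rw [map_neg]; exact neg_mem hz

theorem tensorFrac_mem_iSup (ht : 0 < t) (h : ∀ q b, gr' q b = ⨆ r : Fin t, gr q (t * b + (r : ℕ)))
    {i j : ℤ} {z : (ResBasis 𝒜 →₀ R) ⊗[R] A} (hz : z ∈ tensorGrOf 𝒜 gr' i j) :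
    tensorFrac 𝒜 ht A z ∈
      ⨆ r : Fin t, tensorGrOf (fracGrading t 𝒜) gr i (t * j + (r : ℕ)) := by
  induction hz using AddSubgroup.closure_induction with
  | mem z hz =>
    obtain ⟨p, q, a, b, x, m, rfl, rfl, hx, hm, rfl⟩ := hz
    rw [h] at hm
    obtain ⟨f, hf, rfl⟩ := (mem_iSup_iff_exists_sum _).1 hm
    refine (mem_iSup_iff_exists_sum _).2 ⟨fun r => resFrac 𝒜 ht x ⊗ₜ f r, fun r => ?_,
      (TensorProduct.tmul_sum _ _ _).symm⟩
    exact tmul_mem_tensorGrOf ((resFrac_mem_resGr_iff ht).2 hx) (hf r) rfl (by ring)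
  | zero => rw [map_zero]; exact zero_mem _
  | add y z _ _ hy hz => rw [map_add]; exact add_mem hy hz
  | neg z _ hz => rw [map_neg]; exact neg_mem hz

/-- Nonzero homogeneous elements of the regraded resolution have degrees divisible by `t`, so the
remainder `r` is carried entirely by the module factor. -/
theorem tensorFrac_symm_mem_of_mem_iSup (ht : 0 < t)
    (h : ∀ q b, gr' q b = ⨆ r : Fin t, gr q (t * b + (r : ℕ)))
    {i j : ℤ} {z : (ResBasis (fracGrading t 𝒜) →₀ R) ⊗[R] A}
    (hz : z ∈ ⨆ r : Fin t, tensorGrOf (fracGrading t 𝒜) gr i (t * j + (r : ℕ))) :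
    (tensorFrac 𝒜 ht A).symm z ∈ tensorGrOf 𝒜 gr' i j := by
  obtain ⟨f, hf, rfl⟩ := (mem_iSup_iff_exists_sum _).1 hz
  rw [map_sum]
  refine sum_mem fun r _ => ?_
  have hr := hf r
  generalize f r = z at hr ⊢
  generalize hn : (t : ℤ) * j + (r : ℕ) = n at hr
  induction hr using AddSubgroup.closure_induction with
  | mem z hz =>
    obtain ⟨p, q, a, b, x, m, rfl, rfl, hx, hm, rfl⟩ := hz
    obtain rfl | ⟨a, rfl, hx'⟩ := eq_zero_or_exists_of_mem_resGr_fracGrading ht hx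
    · rw [TensorProduct.zero_tmul, map_zero]
      exact zero_mem _
    · have hb : b = t * (j - a) + (r : ℕ) := by linear_combination -hn
      rw [hb] at hm
      refine tmul_mem_tensorGrOf (b := j - a) hx' ?_ rfl (add_sub_cancel _ _)
      rw [h]
      exact AddSubgroup.mem_iSup_of_mem r hm
  | zero => rw [map_zero]; exact zero_mem _
  | add y z _ _ hy hz => rw [map_add]; exact add_mem hy hz
  | neg z _ hz => rw [map_neg]; exact neg_mem hz

end TensorFracMem

end FracResolution

/-! ### Homology of regraded complexes and of their derived tensor products. -/

namespace GrComplex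

section Regrading

variable {S : Type v} [CommRing S]

theorem mem_frac_gr_iff {t : ℕ} (ht : 0 < t) {M : GrComplex.{v, w} S} {i j : ℤ} {m : M.carrier} :
    m ∈ (M.frac t).gr i j ↔ m = 0 ∨ ∃ j', j = t * j' ∧ m ∈ M.gr i j' := by
  have ht' : (t : ℤ) ≠ 0 := by exact_mod_cast ht.ne'
  change m ∈ (if (t : ℤ) ∣ j then M.gr i (j / t) else ⊥ : AddSubgroup M.carrier) ↔ _
  split_ifs with h
  · obtain ⟨j, rfl⟩ := h
    rw [Int.mul_ediv_cancel_left _ ht']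
    constructor
    · exact fun h => .inr ⟨j, rfl, h⟩
    · rintro (rfl | ⟨j', h, hm⟩)
      · exact zero_mem _
      · rwa [mul_left_cancel₀ ht' h]
  · rw [AddSubgroup.mem_bot]
    exact ⟨.inl, fun h' => h'.resolve_right fun ⟨i, hi, _⟩ => h ⟨i, hi⟩⟩

theorem hasHomology_frac_iff {t : ℕ} (ht : 0 < t) (M : GrComplex.{v, w} S) (i j : ℤ) :
    (M.frac t).HasHomology i j ↔ ∃ j', j = t * j' ∧ M.HasHomology i j' := by
  constructor
  · rintro ⟨z, hz, h0, hn⟩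
    obtain h | ⟨j', rfl, hz'⟩ := (mem_frac_gr_iff ht).1 hz
    · exact (hn 0 (zero_mem _) ((map_zero _).trans h.symm)).elim
    · exact ⟨j', rfl, z, hz', h0, fun x hx => hn x ((mem_frac_gr_iff ht).2 (.inr ⟨j', rfl, hx⟩))⟩
  · rintro ⟨j', rfl, z, hz, h0, hn⟩
    refine ⟨z, (mem_frac_gr_iff ht).2 (.inr ⟨j', rfl, hz⟩), h0, fun x hx h => ?_⟩
    obtain rfl | ⟨j'', h', hx'⟩ := (mem_frac_gr_iff ht).1 hx
    · exact hn 0 (zero_mem _) h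
    · have ht' : (t : ℤ) ≠ 0 := by exact_mod_cast ht.ne'
      rw [← mul_left_cancel₀ ht' h'] at hx'
      exact hn x hx' h

/-- The regrading of a complex whose component of degree `u` is `⨁_{r < d} M_{du+r}`. -/
def coarse (d : ℕ) (M : GrComplex.{v, w} S) : GrComplex.{v, w} S where
  carrier := M.carrier
  d := M.d
  gr i u := ⨆ r : Fin d, M.gr i (d * u + (r : ℕ))

/-- The components of different degrees are independent. -/
def IsSeparated (M : GrComplex.{v, w} S) : Prop :=
  ∀ (i : ℤ) (n : ℕ) (e : Fin n → ℤ) (f : Fin n → M.carrier), Function.Injective e →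
    (∀ r, f r ∈ M.gr i (e r)) → ∑ r, f r = 0 → ∀ r, f r = 0

/-- The differential preserves each fine degree, so every coarse component is a direct sum of `d`
complexes and homology is computed summand by summand. -/
theorem hasHomology_coarse_iff {d : ℕ} {M : GrComplex.{v, w} S}
    (hM : M.IsSeparated) (hdM : ∀ i j, ∀ m ∈ M.gr i j, M.d m ∈ M.gr (i - 1) j) (i u : ℤ) :
    (M.coarse d).HasHomology i u ↔ ∃ r : Fin d, M.HasHomology i (d * u + (r : ℕ)) := by
  classical
  have hinj : Function.Injective fun r : Fin d => (d : ℤ) * u + (r : ℕ) := by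
    intro r s h
    have : ((r : ℕ) : ℤ) = (s : ℕ) := add_left_cancel h
    exact Fin.ext (by exact_mod_cast this)
  constructor
  · rintro ⟨z, hz, h0, hn⟩
    obtain ⟨f, hf, rfl⟩ := (mem_iSup_iff_exists_sum _).1 hz
    change Fin d → M.carrier at f
    by_contra hcon
    simp only [HasHomology, not_exists, not_and, not_forall, not_not] at hcon
    change M.d (∑ r, f r) = 0 at h0
    rw [map_sum] at h0
    -- The components of a cycle are cycles, by independence in homological degree `i - 1`.
    choose g hg hgf using fun r => hcon r (f r) (hf r)
      (hM (i - 1) d _ _ hinj (fun r => hdM _ _ _ (hf r)) h0 r)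
    refine hn (∑ r, g r) ((mem_iSup_iff_exists_sum _).2 ⟨g, hg, rfl⟩) ?_
    change M.d (∑ r, g r) = _
    rw [map_sum]
    exact Finset.sum_congr rfl fun r _ => hgf r
  · rintro ⟨r, z, hz, h0, hn⟩
    refine ⟨z, AddSubgroup.mem_iSup_of_mem r hz, h0, fun x hx h => ?_⟩
    obtain ⟨f, hf, rfl⟩ := (mem_iSup_iff_exists_sum _).1 hx
    change Fin d → M.carrier at f
    change M.d (∑ r, f r) = z at h
    rw [map_sum] at h
    -- Comparison of the components of `∑ d (f s)` and `z` in degree `d * u + r`: only `f r`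
    -- contributes to `z`.
    have key := hM i d _ (fun s => M.d (f s) - Pi.single (M := fun _ => M.carrier) r z s) hinj
      (fun s => by
        refine sub_mem ?_ ?_
        · have := hdM _ _ _ (hf s)
          rwa [add_sub_cancel_right] at this
        · by_cases hs : s = r
          · subst hs
            rwa [Pi.single_eq_same]
          · rw [Pi.single_eq_of_ne hs]
            exact zero_mem _)
      (by rw [Finset.sum_sub_distrib, h, Finset.sum_pi_single']; simp) r
    rw [Pi.single_eq_same, sub_eq_zero] at key
    exact hn (f r) (hf r) key

end Regrading

section TensorRegrading

variable {k : Type u₁} {R : Type u} [Field k] [CommRing R] [Algebra k R]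
  {𝒜 : ℤ → Submodule k R} {t : ℕ}

/-- The derived tensor product commutes with fractional Veronese functors. -/
def derivedTensorFrac (𝒜 : ℤ → Submodule k R) (ht : 0 < t) (N : GrComplex.{u, w} R) :
    GrEquiv ((derivedTensorResidue 𝒜 N).frac t)
      (derivedTensorResidue (fracGrading t 𝒜) (N.frac t)) where
  equiv := tensorFrac 𝒜 ht N.carrier
  map_d z := tensorFrac_tensorTotal ht N.d z
  mem i j z hz := by
    obtain rfl | ⟨j, rfl, hz'⟩ := (mem_frac_gr_iff ht).1 hz
    · exact (map_zero (tensorFrac 𝒜 ht N.carrier)).symm ▸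
        zero_mem (tensorGr (fracGrading t 𝒜) (N.frac t) i j)
    · exact tensorFrac_mem (gr := N.gr) (gr' := (N.frac t).gr) ht
        (fun q b m hm => (mem_frac_gr_iff ht).2 (.inr ⟨b, rfl, hm⟩)) hz'
  symm_mem i j z hz := tensorFrac_symm_mem ht (gr := N.gr) (gr' := (N.frac t).gr)
    (T := ((derivedTensorResidue 𝒜 N).frac t).gr)
    (fun q b m hm => (mem_frac_gr_iff (M := N) ht).1 hm)
    (fun i j z hz =>
      (mem_frac_gr_iff (M := derivedTensorResidue 𝒜 N) ht).2 (.inr ⟨j, rfl, hz⟩)) hz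

/-- The derived tensor products of a complex and of its regrading. -/
def derivedTensorCoarse (𝒜 : ℤ → Submodule k R) (ht : 0 < t) (N : GrComplex.{u, w} R) :
    GrEquiv (derivedTensorResidue 𝒜 (N.coarse t))
      ((derivedTensorResidue (fracGrading t 𝒜) N).coarse t) where
  equiv := tensorFrac 𝒜 ht N.carrier
  map_d z := tensorFrac_tensorTotal ht N.d z
  mem _ _ _ hz := tensorFrac_mem_iSup ht (gr' := (N.coarse t).gr) (fun _ _ => rfl) hz
  symm_mem _ _ _ hz :=
    tensorFrac_symm_mem_of_mem_iSup ht (gr' := (N.coarse t).gr) (fun _ _ => rfl) hz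

-- Coordinates along the homogeneous basis turn `G ⊗ N` into a sum of shifted copies of `N`;
-- independence of degrees is inherited from `N` this way.
open Classical in
theorem finsuppScalarLeft_apply_mem {N : GrComplex.{u, w} R}
    (hN : ∀ (a i b : ℤ) (r : R) (m : N.carrier), r ∈ 𝒜 a → m ∈ N.gr i b → r • m ∈ N.gr i (a + b))
    {n j : ℤ} {z : (ResBasis 𝒜 →₀ R) ⊗[R] N.carrier} (hz : z ∈ tensorGr 𝒜 N n j)
    (b : ResBasis 𝒜) :
    TensorProduct.finsuppScalarLeft R N.carrier (ResBasis 𝒜) z b ∈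
      N.gr (n - b.1) (j - (resStep 𝒜 b.1).deg b.2) := by
  induction hz using AddSubgroup.closure_induction with
  | mem z hz =>
    obtain ⟨p, q, a, a', x, m, rfl, rfl, hx, hm, rfl⟩ := hz
    rw [TensorProduct.finsuppScalarLeft_apply_tmul_apply]
    by_cases h : (b.1 : ℤ) = p
    · rw [h, add_sub_cancel_left, add_sub_right_comm]
      exact hN _ _ _ _ _ (hx b).1 hm
    · rw [(hx b).2 h, zero_smul]
      exact zero_mem _
  | zero => rw [map_zero]; exact zero_mem (N.gr _ _)
  | add y z _ _ hy hz => rw [map_add]; exact add_mem hy hz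
  | neg z _ hz => rw [map_neg]; exact neg_mem hz

theorem isSeparated_derivedTensorResidue {N : GrComplex.{u, w} R}
    (hN : ∀ (a i b : ℤ) (r : R) (m : N.carrier), r ∈ 𝒜 a → m ∈ N.gr i b → r • m ∈ N.gr i (a + b))
    (hN' : N.IsSeparated) : (derivedTensorResidue 𝒜 N).IsSeparated := by
  classical
  intro i n e f he hf h0 r
  let Φ := TensorProduct.finsuppScalarLeft R N.carrier (ResBasis 𝒜)
  change Fin n → (ResBasis 𝒜 →₀ R) ⊗[R] N.carrier at f
  refine (Φ.map_eq_zero_iff).1 (Finsupp.ext fun b => ?_)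
  refine hN' (i - b.1) n (fun r => e r - (resStep 𝒜 b.1).deg b.2) (fun r => Φ (f r) b)
    (fun r s h => he (sub_left_injective h)) (fun r => ?_) ?_ r
  · convert finsuppScalarLeft_apply_mem hN (hf r) b
  have : Φ (∑ r, f r) b = 0 := by
    rw [show ∑ r, f r = 0 from h0, map_zero]
    rfl
  rwa [map_sum, Finsupp.finsetSum_apply] at this

end TensorRegrading

end GrComplex

/-! ## Koszul complexes and regradings -/

namespace GrComplex

section KoszulRegrading

variable {S : Type v} [CommRing S]

theorem koszulOne_frac {t : ℕ} (ht : 0 < t) (M : GrComplex.{v, w} S) (e : ℤ) (x : S) :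
    (M.frac t).koszulOne (t * e) x = (M.koszulOne e x).frac t := by
  have ht' : (t : ℤ) ≠ 0 := by exact_mod_cast ht.ne'
  have h : ((M.frac t).koszulOne (t * e) x).gr = ((M.koszulOne e x).frac t).gr := by
    funext i j
    refine AddSubgroup.ext fun m => ?_
    change m.1 ∈ (if (t : ℤ) ∣ j then M.gr i (j / t) else ⊥ : AddSubgroup M.carrier) ∧
      m.2 ∈ (if (t : ℤ) ∣ j - t * e then M.gr (i - 1) ((j - t * e) / t) else ⊥ :
        AddSubgroup M.carrier) ↔
      m ∈ (if (t : ℤ) ∣ j then (M.gr i (j / t)).prod (M.gr (i - 1) (j / t - e)) else ⊥ :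
        AddSubgroup (M.carrier × M.carrier))
    by_cases hj : (t : ℤ) ∣ j
    · obtain ⟨j, rfl⟩ := hj
      rw [← mul_sub, if_pos (dvd_mul_right _ _), if_pos (dvd_mul_right _ _),
        if_pos (dvd_mul_right _ _), Int.mul_ediv_cancel_left _ ht',
        Int.mul_ediv_cancel_left _ ht']
      rfl
    · rw [if_neg hj, if_neg hj, if_neg fun h => hj ((dvd_sub_left (dvd_mul_right _ _)).1 h),
        ← AddSubgroup.bot_prod_bot]
      rfl
  -- The two complexes share carrier and differential definitionally and differ in the grading
  -- alone.
  exact congrArg (fun gr => { (M.koszulOne e x) with gr := gr }) h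

theorem koszul_frac {t : ℕ} (ht : 0 < t) (M : GrComplex.{v, w} S) (e : ℤ) (xs : List S) :
    (M.frac t).koszul (t * e) xs = (M.koszul e xs).frac t := by
  induction xs with
  | nil => rfl
  | cons x xs ih =>
    rw [koszul, ih, koszulOne_frac ht, koszul]

theorem koszul_isSeparated {M : GrComplex.{v, w} S} (hM : M.IsSeparated) (e : ℤ) (xs : List S) :
    (M.koszul e xs).IsSeparated := by
  induction xs with
  | nil => exact hM
  | cons x xs ih =>
    intro i n a f ha hf h0 r
    let K := M.koszul e xs
    change Fin n → K.carrier × K.carrier at f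
    have h0' : ∑ r, f r = 0 := h0
    refine Prod.ext (ih i n a (fun r => (f r).1) ha (fun r => (hf r).1) ?_ r)
      (ih (i - 1) n (fun r => a r - e) (fun r => (f r).2) (fun r s h => ha (sub_left_injective h))
        (fun r => (hf r).2) ?_ r)
    · exact Prod.fst_sum.symm.trans (congrArg Prod.fst h0')
    · exact Prod.snd_sum.symm.trans (congrArg Prod.snd h0')

end KoszulRegrading

variable {l : Type v₁} {S : Type v} [Field l] [CommRing S] [Algebra l S]
  {𝒮 : ℤ → Submodule l S}

theorem koszul_d_mem {M : GrComplex.{v, w} S} (hM : M.IsGraded 𝒮) {e : ℤ} {xs : List S}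
    (hxs : ∀ x ∈ xs, x ∈ 𝒮 e) (i j : ℤ) (m : (M.koszul e xs).carrier)
    (hm : m ∈ (M.koszul e xs).gr i j) : (M.koszul e xs).d m ∈ (M.koszul e xs).gr (i - 1) j := by
  induction xs generalizing i j with
  | nil => exact hM.d_mem i j m hm
  | cons x xs ih =>
    have hxs' : ∀ x ∈ xs, x ∈ 𝒮 e := fun x hx => hxs x (List.mem_cons_of_mem _ hx)
    have h := koszul_smul_mem hM.smul_mem e xs _ _ _ _ _ (hxs x List.mem_cons_self) hm.2
    rw [add_sub_cancel] at h
    exact ⟨add_mem (ih hxs' i j m.1 hm.1) h,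
      ((M.koszul e xs).gr _ _).neg_mem (ih hxs' (i - 1) (j - e) m.2 hm.2)⟩

theorem IsGraded.isSeparated {M : GrComplex.{v, w} S} (hM : M.IsGraded 𝒮) : M.IsSeparated := by
  classical
  intro i n e f he hf h0 r
  let x : DirectSum (ℤ × ℤ) fun p => M.gr p.1 p.2 :=
    ∑ r, DirectSum.of (fun p : ℤ × ℤ => M.gr p.1 p.2) (i, e r) ⟨f r, hf r⟩
  have hx : x = 0 := by
    refine hM.isInternal.injective ?_
    rw [map_zero, map_sum]
    simpa using h0
  have h : x (i, e r) = ⟨f r, hf r⟩ := by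
    change (∑ s, DirectSum.of (fun p : ℤ × ℤ => M.gr p.1 p.2) (i, e s) ⟨f s, hf s⟩) (i, e r) = _
    rw [DFinsupp.finsetSum_apply, Finset.sum_eq_single r]
    · exact DirectSum.of_eq_same _ _
    · intro s _ hs
      exact DirectSum.of_eq_of_ne _ _ _ fun h => hs (he (congrArg Prod.snd h)).symm
    · simp
  rw [hx] at h
  exact (congrArg Subtype.val h).symm

variable [GradedAlgebra 𝒮]

/-- A shift by `e` in the Veronese grading is a shift by `d * e` in `S`, which leaves the remainder
modulo `d` unchanged. -/
theorem koszulOne_veroneseGraded (M : GrComplex.{v, w} S) (d : ℕ) (e : ℤ) (x : veronese 𝒮 d) :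
    (M.veroneseGraded 𝒮 d).koszulOne e x = (M.koszulOne (d * e) (x : S)).veroneseGraded 𝒮 d := by
  have h : ((M.veroneseGraded 𝒮 d).koszulOne e x).gr =
      ((M.koszulOne (d * e) (x : S)).veroneseGraded 𝒮 d).gr := by
    funext i u
    suffices h : ∀ m : M.carrier × M.carrier, m.1 ∈ (⨆ r : Fin d, M.gr i (d * u + (r : ℕ))) ∧
          m.2 ∈ (⨆ r : Fin d, M.gr (i - 1) (d * (u - e) + (r : ℕ))) ↔
        m ∈ ⨆ r : Fin d, (M.gr i (d * u + (r : ℕ))).prod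
          (M.gr (i - 1) (d * u + (r : ℕ) - d * e)) from AddSubgroup.ext h
    intro m
    simp only [mem_iSup_iff_exists_sum]
    constructor
    · rintro ⟨⟨f, hf, hf'⟩, g, hg, hg'⟩
      refine ⟨fun r => (f r, g r), fun r => ⟨hf r, ?_⟩, Prod.ext ?_ ?_⟩
      · have := hg r
        rwa [mul_sub, sub_add_eq_add_sub] at this
      · exact Prod.fst_sum.trans hf'
      · exact Prod.snd_sum.trans hg'
    · rintro ⟨f, hf, rfl⟩
      refine ⟨⟨fun r => (f r).1, fun r => (hf r).1, Prod.fst_sum.symm⟩,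
        fun r => (f r).2, fun r => ?_, Prod.snd_sum.symm⟩
      rw [mul_sub, sub_add_eq_add_sub]
      exact (hf r).2
  exact congrArg (fun gr => { ((M.koszulOne (d * e) (x : S)).veroneseGraded 𝒮 d) with gr := gr }) h

theorem koszul_veroneseGraded (M : GrComplex.{v, w} S) (d : ℕ) (e : ℤ)
    (ys : List (veronese 𝒮 d)) :
    (M.veroneseGraded 𝒮 d).koszul e ys =
      (M.koszul (d * e) (ys.map Subtype.val)).veroneseGraded 𝒮 d := by
  induction ys with
  | nil => rfl
  | cons y ys ih =>
    rw [koszul, ih, koszulOne_veroneseGraded, List.map_cons, koszul]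

/-- This removes the Veronese ring: over `R` only a coarser grading on the same complex is left. -/
theorem restrict_veroneseGraded {k : Type u₁} {R : Type u} [Field k] [CommRing R] [Algebra k R]
    {𝒜 : ℤ → Submodule k R} [GradedAlgebra 𝒜] {φ : R →+* S} {d : ℕ} (hφ : HasOrder 𝒜 𝒮 φ d)
    (M : GrComplex.{v, w} S) :
    (M.veroneseGraded 𝒮 d).restrict hφ.toVeronese = (M.restrict φ).coarse d := rfl

end GrComplex

/-! ## Algebras generated in one degree -/

section Generation

variable {l : Type v₁} {S : Type v} [Field l] [CommRing S] [Algebra l S]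
  {𝒮 : ℤ → Submodule l S} [GradedAlgebra 𝒮]

theorem pow_le_grading (h n : ℕ) : 𝒮 h ^ n ≤ 𝒮 (h * n : ℕ) := by
  induction n with
  | zero =>
    rw [pow_zero, mul_zero, Submodule.one_le]
    exact SetLike.GradedOne.one_mem (A := 𝒮)
  | succ n ih =>
    rw [pow_succ, Submodule.mul_le]
    intro x hx y hy
    have := SetLike.GradedMul.mul_mem (ih hx) hy
    rwa [← Nat.cast_add] at this

/-- `S` is spanned by products of elements of degree `h`, and taking the component of degree `h * n`
keeps only the products with `n` factors. -/
theorem IsGeneratedInDegree.grading_le_pow {h : ℕ} (hS : IsGeneratedInDegree 𝒮 h) (n : ℕ) :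
    𝒮 (h * n : ℕ) ≤ 𝒮 h ^ n := by
  have hpos := hS.pos
  have key : ∀ x : S, (DirectSum.decompose 𝒮 x ((h * n : ℕ) : ℤ) : S) ∈ 𝒮 h ^ n := by
    intro x
    have hx : x ∈ Algebra.adjoin l (𝒮 h : Set S) := by rw [hS.adjoin]; trivial
    rw [← Subalgebra.mem_toSubmodule, Algebra.adjoin_eq_span] at hx
    induction hx using Submodule.span_induction with
    | mem x hx =>
      obtain ⟨m, hm⟩ : ∃ m : ℕ, x ∈ 𝒮 h ^ m := by
        induction hx using Submonoid.closure_induction with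
        | mem x hx => exact ⟨1, by rwa [pow_one]⟩
        | one => exact ⟨0, by rw [pow_zero]; exact Submodule.one_le.1 le_rfl⟩
        | mul x y _ _ hx hy =>
          obtain ⟨a, ha⟩ := hx
          obtain ⟨b, hb⟩ := hy
          exact ⟨a + b, by rw [pow_add]; exact Submodule.mul_mem_mul ha hb⟩
      have hm' := pow_le_grading h m hm
      by_cases hmn : m = n
      · subst hmn
        rwa [DirectSum.decompose_of_mem_same 𝒮 hm']
      · rw [DirectSum.decompose_of_mem_ne 𝒮 hm' fun hc =>
          hmn (Nat.eq_of_mul_eq_mul_left hpos (by exact_mod_cast hc))]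
        exact zero_mem _
    | zero => simp
    | add x y _ _ hx hy =>
      rw [DirectSum.decompose_add, DirectSum.add_apply, Submodule.coe_add]
      exact add_mem hx hy
    | smul a x _ hx =>
      rw [DirectSum.decompose_smul, DirectSum.smul_apply, Submodule.coe_smul]
      exact Submodule.smul_mem _ _ hx
  intro x hx
  have := key x
  rwa [DirectSum.decompose_of_mem_same 𝒮 hx] at this

theorem submodule_pow_le_ideal_pow {P : Submodule l S} {I : Ideal S} (h : ∀ x ∈ P, x ∈ I) (n : ℕ)
    {x : S} (hx : x ∈ P ^ n) : x ∈ I ^ n := by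
  induction n generalizing x with
  | zero => simp
  | succ n ih =>
    rw [pow_succ] at hx ⊢
    induction hx using Submodule.mul_induction_on' with
    | mem_mul_mem a ha b hb => exact Ideal.mul_mem_mul (ih ha) (h b hb)
    | add a _ b _ ha hb => exact add_mem ha hb

theorem IsGeneratedInDegree.mem_irrelevantIdeal_pow {h : ℕ} (hS : IsGeneratedInDegree 𝒮 h)
    (n : ℕ) {x : S} (hx : x ∈ 𝒮 (h * n : ℕ)) : x ∈ irrelevantIdeal 𝒮 ^ n :=
  submodule_pow_le_ideal_pow (P := 𝒮 h) (I := irrelevantIdeal 𝒮)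
    (fun y (hy : y ∈ 𝒮 h) => Ideal.subset_span ⟨h, by exact_mod_cast hS.pos, hy⟩) n
    (hS.grading_le_pow n hx)

theorem map_veroneseGrading (d : ℕ) (u : ℤ) :
    (veroneseGrading 𝒮 d u).map (veronese 𝒮 d).val.toLinearMap = 𝒮 (d * u) := by
  refine le_antisymm (Submodule.map_comap_le _ _) fun x hx => ?_
  exact ⟨⟨x, Submodule.mem_iSup_of_mem u hx⟩, hx, rfl⟩

/-- With `q = gcd d h`, the equality `d * (h / q) = h * (d / q)` shows that elements of this degree
are sums of products of `n * (d / q)` elements of `S_h`. Grouped by `d / q` factors, they become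
products of `n` elements of Veronese degree `h / q`. -/
theorem IsGeneratedInDegree.mem_irrelevantIdeal_veronese_pow {h : ℕ}
    (hS : IsGeneratedInDegree 𝒮 h) {d : ℕ} (hd : 0 < d) (n : ℕ) {x : veronese 𝒮 d}
    (hx : (x : S) ∈ 𝒮 (d * (h / Nat.gcd d h * n) : ℕ)) :
    x ∈ irrelevantIdeal (veroneseGrading 𝒮 d) ^ n := by
  have hg : 0 < Nat.gcd d h := Nat.gcd_pos_of_pos_left h hd
  have hh' : 0 < h / Nat.gcd d h := Nat.div_pos (Nat.gcd_le_right d hS.pos) hg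
  have hdh : d * (h / Nat.gcd d h) = h * (d / Nat.gcd d h) := by
    rw [← Nat.mul_div_assoc _ (Nat.gcd_dvd_right d h), ← Nat.mul_div_assoc _ (Nat.gcd_dvd_left d h),
      mul_comm]
  have h₁ : (x : S) ∈ 𝒮 ((d * (h / Nat.gcd d h) : ℕ) : ℤ) ^ n := by
    rw [← mul_assoc, hdh, mul_assoc] at hx
    have := hS.grading_le_pow _ hx
    rw [pow_mul] at this
    rw [hdh]
    exact pow_le_pow_left' (pow_le_grading _ _) n this
  rw [Nat.cast_mul, ← map_veroneseGrading (𝒮 := 𝒮) d, ← Submodule.map_pow] at h₁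
  obtain ⟨y, hy, hyx⟩ := h₁
  obtain rfl : y = x := Subtype.ext hyx
  exact submodule_pow_le_ideal_pow
    (P := veroneseGrading 𝒮 d ((h / Nat.gcd d h : ℕ) : ℤ))
    (I := irrelevantIdeal (veroneseGrading 𝒮 d))
    (fun z hz => Ideal.subset_span ⟨((h / Nat.gcd d h : ℕ) : ℤ), by exact_mod_cast hh', hz⟩) n hy

end Generation

/-! ## Betti numbers and regradings -/

section Regularity

variable {k : Type u₁} {l : Type v₁} {R : Type u} {S : Type v} [Field k] [Field l]
  [CommRing R] [CommRing S] [Algebra k R] [Algebra l S]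
  {𝒜 : ℤ → Submodule k R} {𝒮 : ℤ → Submodule l S}

theorem bettiNonzero_frac_iff {t d : ℕ} (ht : 0 < t) (hd : 0 < d) (φ : R →+* S) (e : ℤ)
    (xs : List S) (M : GrComplex.{v, w} S) (i j : ℤ) :
    bettiNonzero (fracGrading t 𝒜) φ d (t * e) xs (M.frac t) i j ↔
      ∃ j', j = t * j' ∧ bettiNonzero 𝒜 φ d e xs M i j' := by
  rw [bettiNonzero, GrComplex.koszul_frac ht, fracGrading_fracGrading d t ht hd]
  exact ((GrComplex.derivedTensorFrac (fracGrading d 𝒜) ht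
    ((M.koszul e xs).restrict φ)).hasHomology_iff i j).symm.trans
    (GrComplex.hasHomology_frac_iff ht _ i j)

theorem bettiShifts_frac {t d : ℕ} (ht : 0 < t) (hd : 0 < d) (φ : R →+* S) (e : ℤ)
    (xs : List S) (M : GrComplex.{v, w} S) :
    bettiShifts (fracGrading t 𝒜) φ d (t * e) xs (M.frac t) =
      (fun q : ℤ => t * q) '' bettiShifts 𝒜 φ d e xs M := by
  ext q
  constructor
  · rintro ⟨i, j, h, rfl⟩
    obtain ⟨j, rfl, h'⟩ := (bettiNonzero_frac_iff ht hd φ e xs M i j).1 h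
    exact ⟨_, ⟨i, j, h', rfl⟩, by ring⟩
  · rintro ⟨_, ⟨i, j, h, rfl⟩, rfl⟩
    exact ⟨i, t * j, (bettiNonzero_frac_iff ht hd φ e xs M i _).2 ⟨j, rfl, h⟩, by ring⟩

/-- The regularity is invariant under fractional Veronese functors. -/
theorem regOver_frac {t d : ℕ} (ht : 0 < t) (hd : 0 < d) (φ : R →+* S) (g : ℕ)
    (xs : List S) (M : GrComplex.{v, w} S) :
    regOver (fracGrading t 𝒜) φ d (t * g) xs (M.frac t) = regOver 𝒜 φ d g xs M := by
  have he : (d : ℤ) * ((t * g : ℕ) : ℤ) = t * (d * g) := by push_cast; ring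
  rw [regOver_eq_sSup, regOver_eq_sSup, he, bettiShifts_frac ht hd, Set.image_image]
  congr 1
  refine Set.image_congr fun q _ => ?_
  have ht' : (t : ℝ) ≠ 0 := by exact_mod_cast ht.ne'
  push_cast
  rw [mul_left_comm (d : ℝ), mul_div_mul_left _ _ ht']

/-- The regularity does not depend on the choice of a sequence of generators of degree `dg`. -/
theorem regOver_eq [GradedAlgebra 𝒜] [GradedAlgebra 𝒮] {φ : R →+* S} {d g : ℕ}
    (hφ : HasOrder 𝒜 𝒮 φ d) {M : GrComplex.{v, w} S} (hM : M.IsGraded 𝒮) {xs ys : List S}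
    (hxs : ∀ x ∈ xs, x ∈ 𝒮 (d * g)) (hys : ∀ y ∈ ys, y ∈ 𝒮 (d * g))
    (hspan : ∀ y ∈ ys, y ∈ Ideal.span {x | x ∈ xs} ⊔ (irrelevantIdeal 𝒜).map φ)
    (hspan' : ∀ x ∈ xs, x ∈ Ideal.span {y | y ∈ ys} ⊔ (irrelevantIdeal 𝒜).map φ) :
    regOver 𝒜 φ d g xs M = regOver 𝒜 φ d g ys M := by
  rw [regOver_eq_sSup, regOver_eq_sSup, bettiShifts_eq hφ hM.smul_mem hxs hys hspan hspan']

theorem regOver_one_eq_sSup (φ : R →+* S) (g : ℕ) (xs : List S) (M : GrComplex.{v, w} S) :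
    regOver 𝒜 φ 1 g xs M =
      sSup ((fun q : ℤ => (((q : ℝ) / g : ℝ) : EReal)) '' bettiShifts 𝒜 φ 1 g xs M) := by
  simp only [regOver_eq_sSup, Nat.cast_one, one_mul]

variable [GradedAlgebra 𝒜] [GradedAlgebra 𝒮]

/-- Koszul complex, restriction and derived tensor product all commute with collecting `d`
consecutive degrees; the homology of the result is then read off degree by degree. -/
theorem bettiNonzero_veronese_iff {φ : R →+* S} {d : ℕ} (hφ : HasOrder 𝒜 𝒮 φ d)
    {M : GrComplex.{v, w} S} (hM : M.IsGraded 𝒮) {e : ℤ} {ys : List (veronese 𝒮 d)}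
    (hys : ∀ y ∈ ys, (y : S) ∈ 𝒮 (d * e)) (i u : ℤ) :
    bettiNonzero 𝒜 hφ.toVeronese 1 e ys (M.veroneseGraded 𝒮 d) i u ↔
      ∃ r : Fin d, bettiNonzero 𝒜 φ d (d * e) (ys.map Subtype.val) M i (d * u + (r : ℕ)) := by
  have : SetLike.GradedMonoid (fracGrading d 𝒜) := gradedMonoid_fracGrading hφ.1
  have hys' : ∀ x ∈ ys.map Subtype.val, x ∈ 𝒮 (d * e) := by
    intro x hx
    obtain ⟨y, hy, rfl⟩ := List.mem_map.1 hx
    exact hys y hy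
  rw [bettiNonzero, GrComplex.koszul_veroneseGraded, fracGrading_one,
    GrComplex.restrict_veroneseGraded hφ]
  let K := M.koszul (d * e) (ys.map Subtype.val)
  have hsmul : ∀ (a i b : ℤ) (r : R) (m : (K.restrict φ).carrier), r ∈ fracGrading d 𝒜 a →
      m ∈ (K.restrict φ).gr i b → r • m ∈ (K.restrict φ).gr i (a + b) := by
    intro a i b r m hr hm
    refine koszul_smul_mem hM.smul_mem (d * e) (ys.map Subtype.val) a i b (φ r) m ?_ hm
    obtain rfl | ⟨a, rfl, hr'⟩ := (mem_fracGrading_iff hφ.1).1 hr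
    · rw [map_zero]
      exact zero_mem _
    · exact hφ.2 a r hr'
  refine ((GrComplex.derivedTensorCoarse 𝒜 hφ.1 (K.restrict φ)).hasHomology_iff i u).trans ?_
  refine GrComplex.hasHomology_coarse_iff ?_ ?_ i u
  · exact GrComplex.isSeparated_derivedTensorResidue hsmul
      (GrComplex.koszul_isSeparated hM.isSeparated _ _)
  · intro i j m hm
    exact tensorD_mem_tensorGr (N := K.restrict φ) (GrComplex.koszul_d_mem hM hys') hm

theorem regOver_veronese_le {φ : R →+* S} {d g : ℕ} (hφ : HasOrder 𝒜 𝒮 φ d) (hg : 0 < g)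
    {M : GrComplex.{v, w} S} (hM : M.IsGraded 𝒮) {ys : List (veronese 𝒮 d)}
    (hys : ∀ y ∈ ys, (y : S) ∈ 𝒮 (d * g)) :
    regOver 𝒜 hφ.toVeronese 1 g ys (M.veroneseGraded 𝒮 d) ≤
      regOver 𝒜 φ d g (ys.map Subtype.val) M := by
  have hg' : (0 : ℝ) < g := by exact_mod_cast hg
  have hd' : (0 : ℝ) < d := by exact_mod_cast hφ.1
  rw [regOver_one_eq_sSup, regOver_eq_sSup]
  refine sSup_le ?_
  rintro _ ⟨_, ⟨i, u, h, rfl⟩, rfl⟩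
  obtain ⟨r, hr⟩ := (bettiNonzero_veronese_iff hφ hM hys i u).1 h
  -- The shift over `S` is `d * (u - i * g) + r` with `r ≥ 0`.
  refine le_sSup_of_le ⟨_, ⟨i, _, hr, rfl⟩, rfl⟩ (EReal.coe_le_coe_iff.2 ?_)
  have hr0 : (0 : ℝ) ≤ ((r : ℕ) : ℝ) := Nat.cast_nonneg _
  push_cast
  rw [div_le_div_iff₀ hg' (mul_pos hd' hg')]
  nlinarith [mul_nonneg hr0 hg'.le]

theorem regOver_le_veronese_add {φ : R →+* S} {d g : ℕ} (hφ : HasOrder 𝒜 𝒮 φ d) (hg : 0 < g)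
    {M : GrComplex.{v, w} S} (hM : M.IsGraded 𝒮) {ys : List (veronese 𝒮 d)}
    (hys : ∀ y ∈ ys, (y : S) ∈ 𝒮 (d * g)) :
    regOver 𝒜 φ d g (ys.map Subtype.val) M ≤
      regOver 𝒜 hφ.toVeronese 1 g ys (M.veroneseGraded 𝒮 d) +
        ((((d : ℝ) - 1) / (d * g) : ℝ) : EReal) := by
  have hg' : (0 : ℝ) < g := by exact_mod_cast hg
  have hd' : (0 : ℝ) < d := by exact_mod_cast hφ.1
  have hdZ : (0 : ℤ) < d := by exact_mod_cast hφ.1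
  rw [regOver_eq_sSup, regOver_one_eq_sSup]
  refine sSup_le ?_
  rintro _ ⟨_, ⟨i, j, h, rfl⟩, rfl⟩
  -- Division of `j` by `d` gives the Veronese degree `u` and a remainder `r ≤ d - 1`, which
  -- accounts for the error term.
  obtain ⟨r, hr⟩ := Int.eq_ofNat_of_zero_le (Int.emod_nonneg j hdZ.ne')
  have hrd : r < d := by
    have := Int.emod_lt_of_pos j hdZ
    rw [hr] at this
    exact_mod_cast this
  have hj : j = d * (j / d) + (r : ℕ) := by rw [← hr]; exact (Int.mul_ediv_add_emod j d).symm
  generalize j / d = u at hj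
  subst hj
  have hu := (bettiNonzero_veronese_iff hφ hM hys i u).2 ⟨⟨r, hrd⟩, h⟩
  have hle : ((((u - i * g : ℤ) : ℝ) / g : ℝ) : EReal) ≤
      sSup ((fun q : ℤ => (((q : ℝ) / g : ℝ) : EReal)) ''
        bettiShifts 𝒜 hφ.toVeronese 1 g ys (M.veroneseGraded 𝒮 d)) :=
    le_sSup ⟨_, ⟨i, u, hu, rfl⟩, rfl⟩
  refine le_trans ?_ (add_le_add_left hle _)
  rw [← EReal.coe_add, EReal.coe_le_coe_iff]
  have hr1 : (r : ℝ) ≤ d - 1 := by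
    have : ((r + 1 : ℕ) : ℝ) ≤ d := by exact_mod_cast hrd
    push_cast at this
    linarith
  have : ((u - i * g : ℤ) : ℝ) / g + ((d : ℝ) - 1) / (d * g) =
      (d * (u - i * g) + (d - 1)) / (d * g) := by
    push_cast
    field_simp
  rw [this]
  refine div_le_div_of_nonneg_right ?_ (mul_pos hd' hg').le
  push_cast
  linarith

end Regularity

end

/-! ### The theorem on fractional and Veronese regradings. -/

theorem mainTheorem6 {k : Type u₁} {l : Type v₁} {R : Type u} {S : Type v} [Field k] [Field l]
    [CommRing R] [CommRing S] [Algebra k R] [Algebra l S]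
    (𝒜 : ℤ → Submodule k R) [GradedAlgebra 𝒜] (𝒮 : ℤ → Submodule l S) [GradedAlgebra 𝒮]
    (g h d c : ℕ) (hR : IsGeneratedInDegree 𝒜 g) (hS : IsGeneratedInDegree 𝒮 h)
    (φ : R →+* S) (hφ : HasOrder 𝒜 𝒮 φ d) (hc : d * g = h * c)
    (M : GrComplex.{v, w} S) (hM : M.IsHomFiniteBelow 𝒮)
    (xs : List S) (hxs : IsMinimalSystem 𝒜 𝒮 φ c (d * g) xs) :
    (∀ t : ℕ, 0 < t → ∀ xs' : List S,
      IsMinimalSystem (fracGrading t 𝒜) (fracGrading t 𝒮) φ c (d * (t * g : ℕ)) xs' →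
      regOver 𝒜 φ d g xs M = regOver (fracGrading t 𝒜) φ d (t * g) xs' (M.frac t)) ∧
    (∀ c' : ℕ, g = h / Nat.gcd d h * c' → ∀ ys : List (veronese 𝒮 d),
      IsMinimalSystem 𝒜 (veroneseGrading 𝒮 d) hφ.toVeronese c' g ys →
      regOver 𝒜 hφ.toVeronese 1 g ys (M.veroneseGraded 𝒮 d) ≤ regOver 𝒜 φ d g xs M ∧
      regOver 𝒜 φ d g xs M ≤ regOver 𝒜 hφ.toVeronese 1 g ys (M.veroneseGraded 𝒮 d) +
        ((((d : ℝ) - 1) / (d * g) : ℝ) : EReal)) := by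
  refine ⟨fun t ht xs' hxs' => ?_, fun c' hc' ys hys => ?_⟩
  · have hxs₁ : ∀ x ∈ xs', x ∈ 𝒮 (d * g) := by
      intro x hx
      have := hxs'.1 x hx
      rwa [show (d : ℤ) * ((t * g : ℕ) : ℤ) = t * (d * g) by push_cast; ring,
        mem_fracGrading_mul ht] at this
    -- Fractional gradings change no ideal, so `xs'` is another system of generators for the
    -- original data.
    have hspan := hxs'.2.1
    rw [irrelevantIdeal_fracGrading ht, irrelevantIdeal_fracGrading ht] at hspan
    rw [regOver_frac ht hφ.1]
    refine regOver_eq hφ hM.isGraded hxs.1 hxs₁ (fun y hy => ?_) (fun x hx => ?_)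
    · rw [hxs.2.1, ← hspan]
      exact Ideal.mem_sup_left (Ideal.subset_span hy)
    · rw [hspan, ← hxs.2.1]
      exact Ideal.mem_sup_left (Ideal.subset_span hx)
  · have hys₁ : ∀ y ∈ ys, (y : S) ∈ 𝒮 (d * g) := fun y hy => hys.1 y hy
    have hdc : d * g = d * (h / Nat.gcd d h * c') := by rw [← hc']
    have hxs_eq : regOver 𝒜 φ d g xs M = regOver 𝒜 φ d g (ys.map Subtype.val) M := by
      refine regOver_eq hφ hM.isGraded hxs.1 ?_ (fun y hy => ?_) (fun x hx => ?_)
      · intro x hx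
        obtain ⟨y, hy, rfl⟩ := List.mem_map.1 hx
        exact hys₁ y hy
      · obtain ⟨y, hy', rfl⟩ := List.mem_map.1 hy
        rw [hxs.2.1]
        -- By `dg = hc`, elements of degree `dg` lie in `𝔫^c`.
        refine hS.mem_irrelevantIdeal_pow c ?_
        rw [← hc]
        exact_mod_cast hys₁ y hy'
      · have hx₁ := hxs.1 x hx
        let x' : veronese 𝒮 d := ⟨x, Submodule.mem_iSup_of_mem (g : ℤ) hx₁⟩
        -- Conversely `x`, viewed in degree `g = (h / gcd d h) * c'` of `S^{(d)}`, is generated by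
        -- `ys` modulo `𝔪S^{(d)}`.
        have hx' : x' ∈ irrelevantIdeal (veroneseGrading 𝒮 d) ^ c' := by
          refine hS.mem_irrelevantIdeal_veronese_pow hφ.1 c' ?_
          rw [← hdc]
          exact_mod_cast hx₁
        rw [← hys.2.1] at hx'
        -- The relation is extended to `S`; there `𝔪S^{(d)}` generates `𝔪S`, because the inclusion
        -- composed with the induced homomorphism is `φ`.
        have := Ideal.mem_map_of_mem (veronese 𝒮 d).val.toRingHom hx'
        rw [Ideal.map_sup, Ideal.map_map, Ideal.map_span] at this
        have hle : Ideal.span ((veronese 𝒮 d).val.toRingHom '' {y | y ∈ ys}) ≤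
            Ideal.span {y | y ∈ ys.map Subtype.val} := by
          refine Ideal.span_mono ?_
          rintro _ ⟨y, hy, rfl⟩
          exact List.mem_map.2 ⟨y, hy, rfl⟩
        exact sup_le_sup_right hle _ this
    rw [hxs_eq]
    exact ⟨regOver_veronese_le hφ hR.pos hM.isGraded hys₁,
      regOver_le_veronese_add hφ hR.pos hM.isGraded hys₁⟩
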